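/- Let $p$ be a prime, let $X$ be a finite connected multigraph (loops and multiple edges allowed), and let $S$ be the set of its edges, each with a fixed orientation. For a voltage assignment $\alpha\colon S\to\mathbb{Z}_p$ and $m\ge 0$, let $X_m$ be the derived graph: its vertices are the pairs $(v,g)$ with $v\in V(X)$ and $g\in\mathbb{Z}/p^m\mathbb{Z}$, and each $e\in S$ from $v$ to $v'$ and each $g$ give one edge from $(v,g)$ to $(v',g+\alpha(e)\bmod p^m)$. A voltage $\mathbb{Z}_p$-cover $X_\infty$ of $X$ is an assignment $\alpha$ for which all the graphs $X_m$ are connected. Let $\mathcal{E}^1(X)$ be the set of all voltage $\mathbb{Z}_p$-covers of $X$, with the topology whose basis consists of the sets $\mathcal{E}(X_\infty,m)$ ($X_\infty\in\mathcal{E}^1(X)$, $m\ge 0$) of all covers $\tilde X_\infty$ whose voltage assignments $\tilde\alpha$ satisfy $\tilde\alpha\equiv\alpha\bmod p^m$. Let $J(X_m)$ be the group of divisors of degree $0$ on $X_m$ with coefficients in $\mathbb{Z}_p$, modulo the $\mathbb{Z}_p$-span of the principal divisors $-\sum_{e}(t(e)-w)$, $w\in V(X_m)$, where $e$ runs over all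 directed edges of $X_m$ with origin $w$, and $t(e)$ is the target of $e$. The projective limit $J_\infty=\varprojlim_m J(X_m)$ is a finitely generated torsion module over $\Lambda=\mathbb{Z}_p[[T]]$, where $1+T$ acts through $(v,g)\mapsto(v,g+1)$. It is pseudo-isomorphic to an elementary module $\bigoplus_i\Lambda/(p^{e_i})\oplus\bigoplus_j\Lambda/(g_j)$ with all $g_j$ coprime to $p$, and its characteristic power series $p^{\sum_i e_i}\prod_j g_j$ is associated to $p^{\mu}G$ with a unique integer $\mu\ge 0$ and a unique distinguished polynomial $G$. Put $\mu(X_\infty)=\mu$ and $\lambda(X_\infty)=\deg G$. Let $X_\infty\in\mathcal{E}^1(X)$ and let $U$ be a neighbourhood of $X_\infty$ in $\mathcal{E}^1(X)$. Then there is a neighbourhood $U'\subseteq U$ of $X_\infty$ such that exactly one of the following holds: either $\mu(\tilde X_\infty)=\mu(X_\infty)$ for each $\tilde X_\infty\in U'$, or $\lambda$ is unbounded on $U'$. -/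

import Mathlib

open scoped Polynomial PowerSeries Topology

/-! ### Finite multigraphs and their Jacobians -/

/-- A multigraph with vertex set `V` and set of undirected edges `E` (loops and multiple edges are
allowed), given together with an orientation: each undirected edge `e` is identified with the
directed edge from `src e` to `tgt e` that is chosen above it. The directed edges of the multigraph
are the chosen ones and their inverses. -/
structure Multigraph (V E : Type*) where
  src : E → V
  tgt : E → V

namespace Multigraph

variable {V E V' E' : Type*}

/-- Connectedness: the vertex set is non-empty, and any two vertices are joined by a path, in which
the edges may be traversed in both directions. -/
def Connected (Y : Multigraph V E) : Prop :=
  (SimpleGraph.fromRel fun v w => ∃ e, Y.src e = v ∧ Y.tgt e = w).Connected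

section Jacobian

/-! Divisors have coefficients in a commutative ring `R`, which is going to be `ℤ_[p]`. -/

variable (R : Type*) [CommRing R]

/-- The divisors: finite formal linear combinations of vertices. -/
def Div (V : Type*) : Type _ := V →₀ R

noncomputable instance (V : Type*) : AddCommGroup (Div R V) :=
  inferInstanceAs (AddCommGroup (V →₀ R))

noncomputable instance (V : Type*) : Module R (Div R V) :=
  inferInstanceAs (Module R (V →₀ R))

variable {R} in
/-- A vertex, considered as a divisor. -/
noncomputable def Div.of (v : V) : Div R V := Finsupp.single v (1 : R)

/-- The push-forward of divisors along a map of vertices. -/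
noncomputable def Div.map (f : V → V') : Div R V →ₗ[R] Div R V' :=
  Finsupp.lmapDomain R R f

theorem Div.map_of (f : V → V') (v : V) : Div.map R f (Div.of v) = Div.of (f v) :=
  Finsupp.mapDomain_single

theorem Div.map_map {V'' : Type*} (f : V → V') (g : V' → V'') (d : Div R V) :
    Div.map R g (Div.map R f d) = Div.map R (g ∘ f) d :=
  Finsupp.mapDomain_comp.symm

theorem Div.map_id (d : Div R V) : Div.map R id d = d :=
  Finsupp.mapDomain_id

/-- The sum of the coefficients of a divisor. -/
noncomputable def degree (V : Type*) : Div R V →ₗ[R] R :=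
  Finsupp.linearCombination R fun _ => (1 : R)

/-- The divisors of degree zero. -/
noncomputable def divZero (V : Type*) : Submodule R (Div R V) :=
  LinearMap.ker (degree R V)

open scoped Classical in
/-- The principal divisor `p_v = - ∑ (t(e) - v)`, where the sum runs over all directed edges `e`
with origin `v`: first the chosen directed edges, then the inverses of the chosen ones. -/
noncomputable def firing [Fintype E] (Y : Multigraph V E) (v : V) : Div R V :=
  -((∑ e : E, if Y.src e = v then Div.of (Y.tgt e) - Div.of v else 0) +
    ∑ e : E, if Y.tgt e = v then Div.of (Y.src e) - Div.of v else 0)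

/-- The principal divisors. -/
noncomputable def principal [Fintype E] (Y : Multigraph V E) : Submodule R (Div R V) :=
  Submodule.span R (Set.range (Y.firing R))

/-- The Jacobian: divisors of degree zero modulo principal divisors. If `R` is `ℤ_[p]` and `Y` is
finite and connected, this is the `p`-Sylow subgroup of the usual Jacobian of `Y`. -/
def Jacobian [Fintype E] (Y : Multigraph V E) : Type _ :=
  divZero R V ⧸ (Y.principal R).submoduleOf (divZero R V)

noncomputable instance [Fintype E] (Y : Multigraph V E) : AddCommGroup (Y.Jacobian R) :=
  inferInstanceAs (AddCommGroup (divZero R V ⧸ (Y.principal R).submoduleOf (divZero R V)))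

noncomputable instance [Fintype E] (Y : Multigraph V E) : Module R (Y.Jacobian R) :=
  inferInstanceAs (Module R (divZero R V ⧸ (Y.principal R).submoduleOf (divZero R V)))

variable {R}

/-- The class of a divisor of degree zero in the Jacobian. -/
noncomputable def Jacobian.mk [Fintype E] (Y : Multigraph V E) : divZero R V →ₗ[R] Y.Jacobian R :=
  ((Y.principal R).submoduleOf (divZero R V)).mkQ

theorem Jacobian.mk_surjective [Fintype E] (Y : Multigraph V E) :
    Function.Surjective (Jacobian.mk (R := R) Y) :=
  Submodule.mkQ_surjective _

theorem degree_mapDomain (f : V → V') (d : Div R V) :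
    degree R V' (Div.map R f d) = degree R V d :=
  Finsupp.linearCombination_mapDomain R f d

/-- The push-forward of divisors of degree zero along a map of vertices. -/
noncomputable def divZeroMap (f : V → V') : divZero R V →ₗ[R] divZero R V' :=
  (Div.map R f).restrict fun d hd => by
    rw [divZero, LinearMap.mem_ker] at hd ⊢
    rw [degree_mapDomain, hd]

theorem divZeroMap_principal [Fintype E] [Fintype E'] {Y : Multigraph V E} {Y' : Multigraph V' E'}
    {f : V → V'} (h : ∀ v, Div.map R f (Y.firing R v) = Y'.firing R (f v)) :
    (Y.principal R).submoduleOf (divZero R V) ≤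
      ((Y'.principal R).submoduleOf (divZero R V')).comap (divZeroMap f) := by
  intro d hd
  have hd' : (d : Div R V) ∈ Y.principal R := hd
  change Div.map R f d ∈ Y'.principal R
  have : Y.principal R ≤ (Y'.principal R).comap (Div.map R f) := by
    refine Submodule.span_le.2 ?_
    rintro _ ⟨v, rfl⟩
    exact Submodule.subset_span ⟨f v, (h v).symm⟩
  exact this hd'

/-- The map of Jacobians that is induced by a map of vertices which respects the divisors `p_v`. -/
noncomputable def jacobianMap [Fintype E] [Fintype E'] {Y : Multigraph V E}
    {Y' : Multigraph V' E'} (f : V → V')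
    (h : ∀ v, Div.map R f (Y.firing R v) = Y'.firing R (f v)) :
    Y.Jacobian R →ₗ[R] Y'.Jacobian R :=
  Submodule.mapQ _ _ (divZeroMap f) (divZeroMap_principal h)

theorem jacobianMap_mk [Fintype E] [Fintype E'] {Y : Multigraph V E} {Y' : Multigraph V' E'}
    (f : V → V') (h : ∀ v, Div.map R f (Y.firing R v) = Y'.firing R (f v))
    (d : divZero R V) :
    jacobianMap f h (Jacobian.mk Y d) = Jacobian.mk Y' (divZeroMap f d) := rfl

end Jacobian

/-! ### Derived graphs of voltage assignments -/

section Derived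

variable {p : ℕ} [Fact p.Prime]

/-- The derived graph `X_m` of a voltage assignment `α` on the chosen directed edges with values in
`ℤ_p`: above each edge `e` from `v` to `v'` there is, for each `g` in `ℤ/p^mℤ`, one edge from
`(v, g)` to `(v', g + α(e) mod p^m)`. -/
noncomputable def derived (X : Multigraph V E) (α : E → ℤ_[p]) (m : ℕ) :
    Multigraph (V × ZMod (p ^ m)) (E × ZMod (p ^ m)) where
  src e := (X.src e.1, e.2)
  tgt e := (X.tgt e.1, e.2 + PadicInt.toZModPow m (α e.1))

/-- The generator `1` of `ℤ/p^mℤ`, acting on the vertices of `X_m`. -/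
def shift (p : ℕ) (V : Type*) (m : ℕ) (w : V × ZMod (p ^ m)) : V × ZMod (p ^ m) :=
  (w.1, w.2 + 1)

/-- The covering map `X_{m+1} → X_m` on vertices. -/
def proj (p : ℕ) (V : Type*) (m : ℕ) (w : V × ZMod (p ^ (m + 1))) : V × ZMod (p ^ m) :=
  (w.1, ZMod.castHom (pow_dvd_pow p m.le_succ) (ZMod (p ^ m)) w.2)

variable (R : Type*) [CommRing R]

open scoped Classical in
theorem firing_derived [Fintype E] (X : Multigraph V E) (α : E → ℤ_[p]) (m : ℕ) (v : V)
    (g : ZMod (p ^ m)) :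
    (X.derived α m).firing R (v, g) =
      -((∑ e : E, if X.src e = v then Div.of (X.tgt e, g + PadicInt.toZModPow m (α e)) -
            Div.of (v, g) else 0) +
        ∑ e : E, if X.tgt e = v then Div.of (X.src e, g - PadicInt.toZModPow m (α e)) -
            Div.of (v, g) else 0) := by
  unfold firing
  rw [Fintype.sum_prod_type, Fintype.sum_prod_type]
  congr 2
  · refine Finset.sum_congr rfl fun e _ => ?_
    by_cases h : X.src e = v
    · rw [Finset.sum_eq_single g]
      · simp [derived, h]
      · intro b _ hb
        simp [derived, hb]
      · simp
    · simp [derived, h]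
  · refine Finset.sum_congr rfl fun e _ => ?_
    by_cases h : X.tgt e = v
    · rw [Finset.sum_eq_single (g - PadicInt.toZModPow m (α e))]
      · simp [derived, h]
      · intro b _ hb
        have : b + PadicInt.toZModPow m (α e) ≠ g := fun hh => hb (by rw [← hh]; ring)
        simp [derived, this]
      · simp
    · simp [derived, h]

theorem mapDomain_shift_firing [Fintype E] (X : Multigraph V E) (α : E → ℤ_[p]) (m : ℕ)
    (w : V × ZMod (p ^ m)) :
    Div.map R (shift p V m) ((X.derived α m).firing R w) =
      (X.derived α m).firing R (shift p V m w) := by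
  classical
  obtain ⟨v, g⟩ := w
  simp only [shift, firing_derived, map_neg, map_add, map_sum]
  congr 2 <;> refine Finset.sum_congr rfl fun e _ => ?_ <;> split_ifs
  · simp only [Div.map_of, map_sub, shift]
    ring_nf
  · simp
  · simp only [Div.map_of, map_sub, shift]
    ring_nf
  · simp

theorem mapDomain_proj_firing [Fintype E] (X : Multigraph V E) (α : E → ℤ_[p]) (m : ℕ)
    (w : V × ZMod (p ^ (m + 1))) :
    Div.map R (proj p V m) ((X.derived α (m + 1)).firing R w) =
      (X.derived α m).firing R (proj p V m w) := by
  classical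
  obtain ⟨v, g⟩ := w
  have key : ∀ x : ℤ_[p], ZMod.castHom (pow_dvd_pow p m.le_succ) (ZMod (p ^ m))
      (PadicInt.toZModPow (m + 1) x) = PadicInt.toZModPow m x := fun x =>
    DFunLike.congr_fun (PadicInt.zmod_cast_comp_toZModPow m (m + 1) m.le_succ) x
  simp only [proj, firing_derived, map_neg, map_add, map_sum]
  congr 2 <;> refine Finset.sum_congr rfl fun e _ => ?_ <;> split_ifs
  · simp only [Div.map_of, map_sub, proj, map_add, key]
  · simp
  · simp only [Div.map_of, map_sub, proj, map_sub, key]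
  · simp

/-- The action on `J(X_m)` of the topological generator `γ = 1` of the Galois group `ℤ_p`. -/
noncomputable def gal [Fintype E] (X : Multigraph V E) (α : E → ℤ_[p]) (m : ℕ) :
    Module.End R ((X.derived α m).Jacobian R) :=
  jacobianMap (shift p V m) (mapDomain_shift_firing R X α m)

/-- The map `J(X_{m+1}) → J(X_m)` induced by the covering map. -/
noncomputable def transition [Fintype E] (X : Multigraph V E) (α : E → ℤ_[p]) (m : ℕ) :
    (X.derived α (m + 1)).Jacobian R →ₗ[R] (X.derived α m).Jacobian R :=
  jacobianMap (proj p V m) (mapDomain_proj_firing R X α m)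

theorem gal_pow [Fintype E] (X : Multigraph V E) (α : E → ℤ_[p]) (m : ℕ) :
    X.gal R α m ^ p ^ m = 1 := by
  have hs : ∀ k : ℕ, (shift p V m)^[k] = fun w => (w.1, w.2 + (k : ZMod (p ^ m))) := by
    intro k
    induction k with
    | zero => ext w <;> simp
    | succ k ih =>
      rw [Function.iterate_succ', ih]
      ext w
      · rfl
      · simp only [Function.comp, shift]
        push_cast
        ring
  have hk : ∀ (k : ℕ) (d : divZero R (V × ZMod (p ^ m))),
      (X.gal R α m ^ k) (Jacobian.mk _ d) =
        Jacobian.mk _ (divZeroMap (shift p V m)^[k] d) := by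
    intro k
    induction k with
    | zero =>
      intro d
      refine congrArg (Jacobian.mk _) ?_
      ext1
      exact (Div.map_id R _).symm
    | succ k ih =>
      intro d
      rw [pow_succ', Module.End.mul_apply, ih]
      refine congrArg (Jacobian.mk _) ?_
      ext1
      change Div.map R _ (Div.map R _ _) = Div.map R _ _
      rw [Div.map_map, ← Function.iterate_succ']
  ext1 x
  obtain ⟨d, rfl⟩ := Jacobian.mk_surjective _ x
  rw [hk, hs]
  refine congrArg (Jacobian.mk _) ?_
  ext1
  change Div.map R _ _ = _
  have : (fun w : V × ZMod (p ^ m) => (w.1, w.2 + ((p ^ m : ℕ) : ZMod (p ^ m)))) = id := by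
    ext w <;> simp
  rw [this, Div.map_id]
  rfl

theorem transition_gal [Fintype E] (X : Multigraph V E) (α : E → ℤ_[p]) (m : ℕ)
    (x : (X.derived α (m + 1)).Jacobian R) :
    X.transition R α m (X.gal R α (m + 1) x) = X.gal R α m (X.transition R α m x) := by
  obtain ⟨d, rfl⟩ := Jacobian.mk_surjective _ x
  refine congrArg (Jacobian.mk _) ?_
  ext1
  change Div.map R _ (Div.map R _ _) = Div.map R _ (Div.map R _ _)
  rw [Div.map_map, Div.map_map]
  congr 2
  funext w
  simp only [Function.comp, shift, proj, map_add, map_one]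

end Derived

end Multigraph

/-! ### The Iwasawa algebra `ℤ_p⟦T⟧` and the Iwasawa invariants of its modules -/

namespace Iwasawa

variable (p : ℕ) [Fact p.Prime]

/-- The polynomial `ω_m = (T + 1)^{p^m} - 1`. -/
noncomputable def omega (m : ℕ) : ℤ_[p][X] := (Polynomial.X + 1) ^ p ^ m - 1

theorem omega_isDistinguishedAt (m : ℕ) :
    (omega p m).IsDistinguishedAt (IsLocalRing.maximalIdeal ℤ_[p]) := by
  have hmon : (omega p m).Monic ∧ (omega p m).natDegree = p ^ m := by
    have h1 : ((Polynomial.X + 1 : ℤ_[p][X]) ^ p ^ m).Monic := (Polynomial.monic_X_add_C 1).pow _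
    have h2 : ((Polynomial.X + 1 : ℤ_[p][X]) ^ p ^ m).natDegree = p ^ m := by
      have h : (Polynomial.X + 1 : ℤ_[p][X]) = Polynomial.X + Polynomial.C 1 := by simp
      rw [h, (Polynomial.monic_X_add_C (1 : ℤ_[p])).natDegree_pow,
        Polynomial.natDegree_X_add_C, mul_one]
    have h3 : (1 : ℤ_[p][X]).degree < ((Polynomial.X + 1 : ℤ_[p][X]) ^ p ^ m).degree := by
      rw [Polynomial.degree_eq_natDegree h1.ne_zero, h2, Polynomial.degree_one]
      exact_mod_cast pow_pos (Fact.out : p.Prime).pos m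
    exact ⟨h1.sub_of_left h3, by
      rw [omega, Polynomial.natDegree_sub_eq_left_of_natDegree_lt, h2]
      rw [h2, Polynomial.natDegree_one]
      exact pow_pos (Fact.out : p.Prime).pos m⟩
  refine ⟨⟨fun {i} hi => ?_⟩, hmon.1⟩
  rw [hmon.2] at hi
  set φ := Ideal.Quotient.mk (IsLocalRing.maximalIdeal ℤ_[p])
  have hp : (p : ℤ_[p] ⧸ IsLocalRing.maximalIdeal ℤ_[p]) = 0 := by
    have : φ (p : ℤ_[p]) = 0 := Ideal.Quotient.eq_zero_iff_mem.2 (by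
      rw [PadicInt.maximalIdeal_eq_span_p]
      exact Ideal.mem_span_singleton_self _)
    simpa using this
  have : CharP (ℤ_[p] ⧸ IsLocalRing.maximalIdeal ℤ_[p]) p :=
    (CharP.charP_iff_prime_eq_zero Fact.out).2 hp
  have hmap : (omega p m).map φ = Polynomial.X ^ p ^ m := by
    simp only [omega, Polynomial.map_sub, Polynomial.map_pow, Polynomial.map_add,
      Polynomial.map_X, Polynomial.map_one]
    rw [add_pow_char_pow, one_pow, add_sub_cancel_right]
  rw [← Ideal.Quotient.eq_zero_iff_mem, ← Polynomial.coeff_map, hmap, Polynomial.coeff_X_pow,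
    if_neg hi.ne]

variable {p}

section Action

variable {A : Type*} [AddCommGroup A] [Module ℤ_[p] A] (m : ℕ) (τ : Module.End ℤ_[p] A)

/-- If an endomorphism `τ` of a `ℤ_p`-module satisfies `ω_m(τ) = 0`, the ring `ℤ_p⟦T⟧` acts on the
module through `ℤ_p⟦T⟧ → ℤ_p⟦T⟧/(ω_m) = ℤ_p[T]/(ω_m)`, with `T` acting as `τ`. -/
noncomputable def action (h : Polynomial.aeval τ (omega p m) = 0) :
    ℤ_[p]⟦X⟧ →ₐ[ℤ_[p]] Module.End ℤ_[p] A :=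
  ((Ideal.Quotient.liftₐ (Ideal.span {omega p m}) (Polynomial.aeval τ) fun a ha => by
      obtain ⟨b, rfl⟩ := Ideal.mem_span_singleton'.1 ha
      rw [map_mul, h, mul_zero]).comp
    ((omega_isDistinguishedAt p m).algEquivQuotient.symm :
      (ℤ_[p]⟦X⟧ ⧸ Ideal.span {(omega p m : ℤ_[p]⟦X⟧)}) →ₐ[ℤ_[p]]
        ℤ_[p][X] ⧸ Ideal.span {omega p m})).comp
    (Ideal.Quotient.mkₐ ℤ_[p] (Ideal.span {(omega p m : ℤ_[p]⟦X⟧)}))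

theorem action_eq_aeval (h : Polynomial.aeval τ (omega p m) = 0) {f : ℤ_[p]⟦X⟧} {r : ℤ_[p][X]}
    (hfr : (omega p m : ℤ_[p]⟦X⟧) ∣ f - r) : action m τ h f = Polynomial.aeval τ r := by
  have h1 : (Ideal.Quotient.mkₐ ℤ_[p] (Ideal.span {(omega p m : ℤ_[p]⟦X⟧)})) f =
      (omega_isDistinguishedAt p m).algEquivQuotient (Ideal.Quotient.mk _ r) := by
    rw [Polynomial.IsDistinguishedAt.algEquivQuotient_apply]
    exact Ideal.Quotient.eq.2 (Ideal.mem_span_singleton.2 hfr)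
  unfold action
  rw [AlgHom.comp_apply, h1, AlgHom.comp_apply, AlgEquiv.coe_toAlgHom, AlgEquiv.symm_apply_apply]
  rfl

theorem exists_remainder (f : ℤ_[p]⟦X⟧) : ∃ r : ℤ_[p][X], (omega p m : ℤ_[p]⟦X⟧) ∣ f - r := by
  obtain ⟨y, hy⟩ := (omega_isDistinguishedAt p m).algEquivQuotient.surjective
    (Ideal.Quotient.mk _ f)
  obtain ⟨r, rfl⟩ := Ideal.Quotient.mk_surjective y
  refine ⟨r, Ideal.mem_span_singleton.1 (Ideal.Quotient.eq.1 ?_)⟩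
  rw [← hy, Polynomial.IsDistinguishedAt.algEquivQuotient_apply]
  rfl

end Action

theorem omega_dvd_omega_succ (m : ℕ) : omega p m ∣ omega p (m + 1) := by
  rw [omega, omega, pow_succ, pow_mul]
  exact sub_one_dvd_pow_sub_one _ _

variable (p)

/-- A `ℤ_p⟦T⟧`-module is pseudo-null if it is annihilated by two relatively prime elements. -/
def IsPseudoNull (A : Type*) [AddCommGroup A] [Module ℤ_[p]⟦X⟧ A] : Prop :=
  ∃ f g : ℤ_[p]⟦X⟧, IsRelPrime f g ∧ ∀ a : A, f • a = 0 ∧ g • a = 0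

/-- A pseudo-isomorphism: kernel and cokernel are pseudo-null. -/
def IsPseudoIsomorphism {A B : Type*} [AddCommGroup A] [Module ℤ_[p]⟦X⟧ A] [AddCommGroup B]
    [Module ℤ_[p]⟦X⟧ B] (φ : A →ₗ[ℤ_[p]⟦X⟧] B) : Prop :=
  IsPseudoNull p (LinearMap.ker φ) ∧ IsPseudoNull p (B ⧸ LinearMap.range φ)

/-- The elementary module `⨁ Λ/(p^{e_i}) ⊕ ⨁ Λ/(g_j)` over `Λ = ℤ_p⟦T⟧`. -/
abbrev Elementary {s t : ℕ} (e : Fin s → ℕ) (g : Fin t → ℤ_[p]⟦X⟧) : Type :=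
  (∀ i, ℤ_[p]⟦X⟧ ⧸ Ideal.span {(p : ℤ_[p]⟦X⟧) ^ e i}) × (∀ j, ℤ_[p]⟦X⟧ ⧸ Ideal.span {g j})

/-- `F` is a characteristic power series of `A`: there is a pseudo-isomorphism from `A` to an
elementary module `⨁ Λ/(p^{e_i}) ⊕ ⨁ Λ/(g_j)`, where the `g_j` are coprime with `p`, such that
`F = p^{∑ e_i} ∏ g_j`. -/
def IsCharacteristicPowerSeries (A : Type*) [AddCommGroup A] [Module ℤ_[p]⟦X⟧ A]
    (F : ℤ_[p]⟦X⟧) : Prop :=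
  ∃ (s t : ℕ) (e : Fin s → ℕ) (g : Fin t → ℤ_[p]⟦X⟧),
    (∀ j, IsRelPrime (g j) (p : ℤ_[p]⟦X⟧)) ∧
    (∃ φ : A →ₗ[ℤ_[p]⟦X⟧] Elementary p e g, IsPseudoIsomorphism p φ) ∧
    F = (p : ℤ_[p]⟦X⟧) ^ (∑ i, e i) * ∏ j, g j

/-- `A` has a characteristic power series that is associated to `p^m G` for a distinguished
polynomial `G` of degree `l`. -/
def HasInvariants (A : Type*) [AddCommGroup A] [Module ℤ_[p]⟦X⟧ A] (m l : ℕ) : Prop :=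
  ∃ (F : ℤ_[p]⟦X⟧) (G : ℤ_[p][X]), IsCharacteristicPowerSeries p A F ∧
    G.IsDistinguishedAt (IsLocalRing.maximalIdeal ℤ_[p]) ∧
    Associated F ((p : ℤ_[p]⟦X⟧) ^ m * (G : ℤ_[p]⟦X⟧)) ∧ G.natDegree = l

/-- The `μ`-invariant. For a finitely generated torsion module `A` there is exactly one pair
`(m, l)` such that `HasInvariants p A m l`, so that the infimum is over a one-element set. -/
noncomputable def mu (A : Type*) [AddCommGroup A] [Module ℤ_[p]⟦X⟧ A] : ℕ :=
  sInf {m | ∃ l, HasInvariants p A m l}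

/-- The `λ`-invariant. -/
noncomputable def lam (A : Type*) [AddCommGroup A] [Module ℤ_[p]⟦X⟧ A] : ℕ :=
  sInf {l | ∃ m, HasInvariants p A m l}

end Iwasawa

/-! ### The Iwasawa module of a voltage assignment -/

namespace Multigraph

variable {V E : Type*} [Fintype E] {p : ℕ} [Fact p.Prime]

/-- The Jacobian `J(X_m)` of the derived graph, with coefficients in `ℤ_p`. -/
def LevelJacobian (X : Multigraph V E) (α : E → ℤ_[p]) (m : ℕ) : Type _ :=
  (X.derived α m).Jacobian ℤ_[p]

noncomputable instance (X : Multigraph V E) (α : E → ℤ_[p]) (m : ℕ) :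
    AddCommGroup (X.LevelJacobian α m) :=
  inferInstanceAs (AddCommGroup ((X.derived α m).Jacobian ℤ_[p]))

theorem aeval_gal (X : Multigraph V E) (α : E → ℤ_[p]) {m k : ℕ} (h : m ≤ k) :
    Polynomial.aeval (X.gal ℤ_[p] α m - 1) (Iwasawa.omega p k) = 0 := by
  obtain ⟨j, rfl⟩ := Nat.exists_eq_add_of_le h
  simp [Iwasawa.omega, pow_add, pow_mul, gal_pow]

/-- The action of `ℤ_p⟦T⟧` on `J(X_m)`, where `T + 1` acts as the generator `γ` of the Galois
group. -/
noncomputable def levelAction (X : Multigraph V E) (α : E → ℤ_[p]) (m : ℕ) :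
    ℤ_[p]⟦X⟧ →ₐ[ℤ_[p]] Module.End ℤ_[p] ((X.derived α m).Jacobian ℤ_[p]) :=
  Iwasawa.action m (X.gal ℤ_[p] α m - 1) (aeval_gal X α le_rfl)

noncomputable instance (X : Multigraph V E) (α : E → ℤ_[p]) (m : ℕ) :
    Module ℤ_[p]⟦X⟧ (X.LevelJacobian α m) :=
  Module.compHom ((X.derived α m).Jacobian ℤ_[p]) (X.levelAction α m).toRingHom

theorem aeval_intertwine {R M N : Type*} [CommRing R] [AddCommGroup M] [Module R M]
    [AddCommGroup N] [Module R N] {σ : Module.End R M} {τ : Module.End R N} (π : M →ₗ[R] N)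
    (h : ∀ x, π (σ x) = τ (π x)) (r : R[X]) (x : M) :
    π (Polynomial.aeval σ r x) = Polynomial.aeval τ r (π x) := by
  have hpow : ∀ (n : ℕ) (x : M), π ((σ ^ n) x) = (τ ^ n) (π x) := by
    intro n
    induction n with
    | zero => intro x; rfl
    | succ n ih => intro x; rw [pow_succ, pow_succ, Module.End.mul_apply, ih, h,
        Module.End.mul_apply]
  induction r using Polynomial.induction_on' with
  | add a b ha hb => simp only [map_add, LinearMap.add_apply, ha, hb]
  | monomial n a =>
    simp only [Polynomial.aeval_monomial, Module.End.mul_apply, Module.algebraMap_end_apply,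
      map_smul, hpow]

theorem transition_smul (X : Multigraph V E) (α : E → ℤ_[p]) (m : ℕ) (f : ℤ_[p]⟦X⟧)
    (x : (X.derived α (m + 1)).Jacobian ℤ_[p]) :
    X.transition ℤ_[p] α m (X.levelAction α (m + 1) f x) =
      X.levelAction α m f (X.transition ℤ_[p] α m x) := by
  obtain ⟨r, hr⟩ := Iwasawa.exists_remainder (m + 1) f
  have hd : (Iwasawa.omega p m : ℤ_[p]⟦X⟧) ∣ (Iwasawa.omega p (m + 1) : ℤ_[p]⟦X⟧) :=
    map_dvd (Polynomial.coeToPowerSeries.ringHom (R := ℤ_[p])) (Iwasawa.omega_dvd_omega_succ m)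
  rw [levelAction, levelAction, Iwasawa.action_eq_aeval _ _ _ hr,
    Iwasawa.action_eq_aeval _ _ _ (hd.trans hr)]
  refine aeval_intertwine _ (fun y => ?_) r x
  simp only [LinearMap.sub_apply, Module.End.one_apply, map_sub, transition_gal]

/-- The Iwasawa module `J_∞` of a voltage assignment: the projective limit of the Jacobians
`J(X_m)`. -/
noncomputable def jacobianLimit (X : Multigraph V E) (α : E → ℤ_[p]) :
    Submodule ℤ_[p]⟦X⟧ (∀ m, X.LevelJacobian α m) where
  carrier := {x | ∀ m, X.transition ℤ_[p] α m (x (m + 1)) = x m}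
  zero_mem' m := map_zero (X.transition ℤ_[p] α m)
  add_mem' {x y} hx hy m :=
    (map_add (X.transition ℤ_[p] α m) (x (m + 1)) (y (m + 1))).trans
      (congrArg₂ _ (hx m) (hy m))
  smul_mem' f x hx m :=
    (transition_smul X α m f (x (m + 1))).trans (congrArg (X.levelAction α m f) (hx m))

end Multigraph

/-! ### The space of voltage `ℤ_p`-covers -/

/-- A voltage `ℤ_p`-cover `X_∞` of `X`: a voltage assignment with values in `ℤ_p` all of whose
derived graphs `X_m` are connected. (In particular `X_0`, that is `X`, is connected.) -/
structure VoltageCover (p : ℕ) [Fact p.Prime] {V E : Type*} (X : Multigraph V E) where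
  voltage : E → ℤ_[p]
  connected : ∀ m, (X.derived voltage m).Connected

namespace VoltageCover

variable {p : ℕ} [Fact p.Prime] {V E : Type*} {X : Multigraph V E}

/-- The set of voltage covers whose voltage assignment agrees with that of `Y` modulo `p^m`. -/
def basic (Y : VoltageCover p X) (m : ℕ) : Set (VoltageCover p X) :=
  {Z | ∀ e, PadicInt.toZModPow m (Z.voltage e) = PadicInt.toZModPow m (Y.voltage e)}

/-- The topology for which the sets `basic Y m` form a basis. -/
instance : TopologicalSpace (VoltageCover p X) :=
  TopologicalSpace.generateFrom {s | ∃ Y m, s = basic Y m}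

variable [Fintype E]

/-- The `μ`-invariant of a voltage cover: that of the Iwasawa module `J_∞`. -/
noncomputable def mu (Y : VoltageCover p X) : ℕ :=
  Iwasawa.mu p (X.jacobianLimit Y.voltage)

/-- The `λ`-invariant of a voltage cover: that of the Iwasawa module `J_∞`. -/
noncomputable def lam (Y : VoltageCover p X) : ℕ :=
  Iwasawa.lam p (X.jacobianLimit Y.voltage)

end VoltageCover

/-! Write Λ = ℤ_p⟦T⟧ and ω_m = (1+T)^{p^m} - 1. The divisors of X_m form (Λ/ω_m)^V, and one matrix
over Λ built from the powers (1+T)^{±α(e)}, the voltage Laplacian `lap`, induces the Laplacians of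
all the X_m. Compactness of Λ identifies J_∞ with the vectors of degree zero in Λ^V modulo the image
of this matrix. As the degree takes values in Λ/(T), there is an exact sequence 0 → J_∞ → coker →
Λ/(T) → 0 (`exact_cokernelDegree`). Connectedness of the X_m makes the determinant D non-zero, and
comparing lengths at every prime element of Λ shows that D is associated to T times a characteristic
power series of J_∞ (`ordAt_det_lap`). Hence μ is the least p-adic valuation of a coefficient of D,
and λ + 1 is the first index where it is attained (`hasShape_det_lap`).

If two voltage assignments agree modulo p^n, their determinants agree modulo ω_n, and the low
coefficients of a multiple of ω_n are divisible by a high power of p (`pow_dvd_coeff_of_omega_dvd`).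
Close to X_∞ the coefficients up to index λ + 1 therefore agree modulo p^{μ+1}: μ cannot grow, and
if it stays the same, so does λ. If μ drops, all coefficients up to a prescribed index N are still
divisible by the old p^μ, which forces the new λ to be at least N. So either μ is constant on some
small basic neighbourhood, where λ is then constant too, or covers with smaller μ exist arbitrarily
close to X_∞ and λ is unbounded. -/

/-! ### Localization of a factorial ring at the elements coprime to a given one -/

section CoprimeLocalization

set_option linter.unusedSectionVars false

variable {A : Type*} [CommRing A] [IsDomain A] [UniqueFactorizationMonoid A]

/-- The multiplicative set of elements that are relatively prime to `F`. -/
def coprimeSubmonoid (F : A) : Submonoid A where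
  carrier := {s | IsRelPrime s F}
  one_mem' := isRelPrime_one_left
  mul_mem' := fun ha hb => IsRelPrime.mul_left ha hb

theorem coprimeSubmonoid_le_nonZeroDivisors {F : A} (hF : ¬ IsUnit F) :
    coprimeSubmonoid F ≤ nonZeroDivisors A := by
  intro s hs
  refine mem_nonZeroDivisors_of_ne_zero ?_
  rintro rfl
  exact hF (isRelPrime_zero_left.1 hs)

theorem exists_prime_dvd_of_not_isRelPrime {F y : A} (hF : F ≠ 0) (h : ¬ IsRelPrime y F) :
    ∃ q, Prime q ∧ q ∣ y ∧ q ∣ F := by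
  simp only [IsRelPrime, not_forall] at h
  obtain ⟨d, hdy, hdF, hd⟩ := h
  obtain ⟨q, hq, hqd⟩ := WfDvdMonoid.exists_irreducible_factor hd (ne_zero_of_dvd_ne_zero hF hdF)
  exact ⟨q, UniqueFactorizationMonoid.irreducible_iff_prime.1 hq, hqd.trans hdy, hqd.trans hdF⟩

theorem isRelPrime_of_prime_of_not_dvd {q y : A} (hq : Prime q) (h : ¬ q ∣ y) :
    IsRelPrime y q :=
  ((hq.irreducible.isRelPrime_iff_not_dvd).2 h).symm

variable (R : Type*) [CommRing R] [Algebra A R]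

/-- The contraction of P contains no element coprime to F, so it lies in the union of the ideals
generated by the prime factors of F. Prime avoidance places it in a single (r). Being a non-zero
prime ideal of a factorial ring it also contains a prime element q; then q is associated to r, and
the contraction is (q). -/
theorem Ideal.exists_prime_eq_span_of_coprimeSubmonoid {F : A} (hF : F ≠ 0)
    [IsLocalization (coprimeSubmonoid F) R] (P : Ideal R) [hP : P.IsPrime] (hP0 : P ≠ ⊥) :
    ∃ q : A, Prime q ∧ q ∣ F ∧ P = Ideal.span {algebraMap A R q} := by
  classical
  set Q : Ideal A := P.comap (algebraMap A R) with hQ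
  have hmap : Q.map (algebraMap A R) = P := IsLocalization.map_under (coprimeSubmonoid F) R P
  have hQ0 : Q ≠ ⊥ := by
    intro h
    rw [h, Ideal.map_bot] at hmap
    exact hP0 hmap.symm
  obtain ⟨q, hqQ, hq⟩ := Ideal.IsPrime.exists_mem_prime_of_ne_bot (I := Q) inferInstance hQ0
  have hdisj : ∀ y ∈ Q, ¬ IsRelPrime y F := by
    intro y hy hyF
    refine hP.ne_top (Ideal.eq_top_of_isUnit_mem _ hy ?_)
    exact IsLocalization.map_units R (⟨y, hyF⟩ : coprimeSubmonoid F)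
  have hsub : (Q : Set A) ⊆ ⋃ i ∈ (↑(UniqueFactorizationMonoid.factors F).toFinset : Set A),
      (Ideal.span {i} : Ideal A) := by
    intro y hy
    obtain ⟨r, hr, hry, hrF⟩ := exists_prime_dvd_of_not_isRelPrime hF (hdisj y hy)
    obtain ⟨r', hr', hrr'⟩ :=
      UniqueFactorizationMonoid.exists_mem_factors_of_dvd hF hr.irreducible hrF
    simp only [Set.mem_iUnion]
    exact ⟨r', by simpa using hr', Ideal.mem_span_singleton.2 (hrr'.symm.dvd.trans hry)⟩
  obtain ⟨r, hr, hQr⟩ := (Ideal.subset_union_prime 0 0 fun i hi _ _ => by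
    have hi' : i ∈ UniqueFactorizationMonoid.factors F := by simpa using hi
    have := UniqueFactorizationMonoid.prime_of_factor i hi'
    exact (Ideal.span_singleton_prime this.ne_zero).2 this).1 hsub
  have hr' : r ∈ UniqueFactorizationMonoid.factors F := by simpa using hr
  have hrp := UniqueFactorizationMonoid.prime_of_factor r hr'
  have hrq : r ∣ q := Ideal.mem_span_singleton.1 (hQr hqQ)
  have has : Associated r q := hrp.associated_of_dvd hq hrq
  refine ⟨q, hq, has.symm.dvd.trans (UniqueFactorizationMonoid.dvd_of_mem_factors hr'), ?_⟩
  have : Q = Ideal.span {q} := by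
    refine le_antisymm (hQr.trans ?_) ((Ideal.span_singleton_le_iff_mem _).2 hqQ)
    rw [Ideal.span_singleton_le_span_singleton]
    exact has.symm.dvd
  rw [← hmap, this, Ideal.map_span, Set.image_singleton]

/-- Principal prime ideals suffice. Although Λ has dimension two, this makes Smith normal forms and
the structure theorem available after localization. -/
theorem isPrincipalIdealRing_of_coprimeSubmonoid {F : A} (hF : F ≠ 0)
    [IsLocalization (coprimeSubmonoid F) R] : IsPrincipalIdealRing R := by
  refine IsPrincipalIdealRing.of_prime fun P hP => ?_
  by_cases h : P = ⊥
  · rw [h]; infer_instance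
  · obtain ⟨q, -, -, hq⟩ := Ideal.exists_prime_eq_span_of_coprimeSubmonoid R hF P h
    exact ⟨⟨_, hq⟩⟩

theorem Irreducible.exists_prime_associated_of_coprimeSubmonoid [IsDomain R] {F : A} (hF : F ≠ 0)
    [IsLocalization (coprimeSubmonoid F) R] {x : R} (hx : Irreducible x) :
    ∃ q : A, Prime q ∧ q ∣ F ∧ Associated x (algebraMap A R q) := by
  have := isPrincipalIdealRing_of_coprimeSubmonoid R hF
  have hxp := hx.prime
  have : (Ideal.span {x}).IsPrime := (Ideal.span_singleton_prime hxp.ne_zero).2 hxp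
  obtain ⟨q, hq, hqF, h⟩ := Ideal.exists_prime_eq_span_of_coprimeSubmonoid R hF (Ideal.span {x})
    (by simpa using hxp.ne_zero)
  exact ⟨q, hq, hqF, Ideal.span_singleton_eq_span_singleton.1 h⟩

theorem irreducible_algebraMap_of_coprimeSubmonoid [IsDomain R] {q : A} (hq : Prime q)
    [IsLocalization (coprimeSubmonoid q) R] : Irreducible (algebraMap A R q) := by
  refine Prime.irreducible ?_
  rw [← Ideal.span_singleton_prime, ← Set.image_singleton, ← Ideal.map_span]
  · have : (Ideal.span {q}).IsPrime := (Ideal.span_singleton_prime hq.ne_zero).2 hq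
    refine IsLocalization.isPrime_of_isPrime_disjoint (coprimeSubmonoid q) R _ this ?_
    rw [Set.disjoint_left]
    intro s hs hsq
    exact hq.not_isUnit (hs (Ideal.mem_span_singleton.1 hsq) dvd_rfl)
  · have := IsLocalization.injective R (coprimeSubmonoid_le_nonZeroDivisors hq.not_isUnit)
    exact fun h => hq.ne_zero (this (by rw [h, map_zero]))

end CoprimeLocalization

/-! ### Lengths of cokernels over a principal ideal domain -/

section CokernelLength

open Module

/-- By the Smith normal form the quotient is a sum of modules R/(a_i). The map L differs from the
diagonal one by an automorphism, so its determinant is ∏ a_i up to a unit, and orders are additive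
on products. -/
theorem Module.length_pi_quotient_range_mulVecLin {R : Type*} [CommRing R] [IsDomain R]
    [IsPrincipalIdealRing R] {ι : Type*} [Fintype ι] [DecidableEq ι] (L : Matrix ι ι R)
    (hL : L.det ≠ 0) :
    Module.length R ((ι → R) ⧸ LinearMap.range L.mulVecLin) = Ring.ord R L.det := by
  classical
  have hinj : Function.Injective L.mulVecLin := by
    rw [← LinearMap.ker_eq_bot, LinearMap.ker_eq_bot']
    intro v hv
    by_contra h
    exact hL (Matrix.exists_mulVec_eq_zero_iff.1 ⟨v, h, hv⟩)
  set N := LinearMap.range L.mulVecLin with hN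
  let f : (ι → R) ≃ₗ[R] N := LinearEquiv.ofInjective _ hinj
  let b := Pi.basisFun R ι
  have hrank : finrank R N = finrank R (ι → R) := f.finrank_eq.symm
  rw [(Submodule.quotientEquivPiSpan N b hrank).length_eq, Module.length_pi_of_fintype]
  let a := Submodule.smithNormalFormCoeffs b hrank
  let b' := Submodule.smithNormalFormTopBasis b hrank
  let ab := Submodule.smithNormalFormBotBasis b hrank
  have ab_eq : ∀ i, (ab i : ι → R) = a i • b' i := Submodule.smithNormalFormBotBasis_def b hrank
  let e : (ι → R) ≃ₗ[R] N := b'.equiv ab (Equiv.refl ι)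
  have hfac : L.mulVecLin = (N.subtype ∘ₗ e.toLinearMap) ∘ₗ (f.trans e.symm).toLinearMap := by
    refine LinearMap.ext fun x => ?_
    change L.mulVecLin x = (e (e.symm (f x)) : ι → R)
    rw [LinearEquiv.apply_symm_apply]
    rfl
  have hdiag : LinearMap.toMatrix b' b' (N.subtype ∘ₗ e.toLinearMap) = Matrix.diagonal a := by
    ext i j
    rw [LinearMap.toMatrix_apply]
    simp only [LinearMap.comp_apply, LinearEquiv.coe_coe, e, Basis.equiv_apply,
      Equiv.refl_apply, Submodule.subtype_apply, ab_eq, map_smul, Basis.repr_self]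
    by_cases h : i = j
    · subst h; simp
    · simp [h]
  have hdet : L.det = (∏ i, a i) * LinearMap.det (f.trans e.symm).toLinearMap := by
    rw [← Matrix.det_diagonal, ← hdiag, LinearMap.det_toMatrix, ← LinearMap.det_comp, ← hfac,
      ← Matrix.toLin'_apply', LinearMap.det_toLin']
  have hu : IsUnit (LinearMap.det (f.trans e.symm).toLinearMap) := LinearEquiv.isUnit_det' _
  have ha : ∀ s : Finset ι, Ring.ord R (∏ i ∈ s, a i) = ∑ i ∈ s, Ring.ord R (a i) := by
    intro s
    have hne : ∀ i, a i ≠ 0 := by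
      intro i hi
      rw [hdet, Finset.prod_eq_zero (Finset.mem_univ i) hi, zero_mul] at hL
      exact hL rfl
    induction s using Finset.induction_on with
    | empty => simp
    | insert i s hi ih =>
      rw [Finset.prod_insert hi, Finset.sum_insert hi, Ring.ord_mul, ih]
      exact mem_nonZeroDivisors_of_ne_zero (Finset.prod_ne_zero_iff.2 fun i _ => hne i)
  rw [hdet, Ring.ord_mul_of_isUnit_right hu, ha]
  rfl

end CokernelLength

/-! ### Lengths after localization at a prime element -/

section LocalLength

variable {A : Type*} [CommRing A]

/-- The length of the localization of `M` at the elements that are relatively prime to `q`. -/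
noncomputable def localLength [IsDomain A] [UniqueFactorizationMonoid A] (q : A) (M : Type*)
    [AddCommGroup M] [Module A M] : ℕ∞ :=
  Module.length (Localization (coprimeSubmonoid q)) (LocalizedModule (coprimeSubmonoid q) M)

/-- The order of an element with respect to the localization at the elements that are relatively
prime to `q`. -/
noncomputable def ordAt [IsDomain A] [UniqueFactorizationMonoid A] (q a : A) : ℕ∞ :=
  Ring.ord (Localization (coprimeSubmonoid q)) (algebraMap A _ a)

theorem Submodule.localized'_range_mulVecLin {R : Type*} [CommRing R] [Algebra A R]
    (S : Submonoid A) [IsLocalization S R] {ι : Type*} [Fintype ι] [DecidableEq ι]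
    (L : Matrix ι ι A) :
    (LinearMap.range L.mulVecLin).localized' R S
        (.pi fun i ↦ Algebra.linearMap A R ∘ₗ .proj i : (ι → A) →ₗ[A] (ι → R)) =
      LinearMap.range (L.map (algebraMap A R)).mulVecLin := by
  rw [Submodule.localized'_eq_span]
  apply le_antisymm
  · rw [Submodule.span_le]
    rintro _ ⟨_, ⟨v, rfl⟩, rfl⟩
    refine ⟨fun i => algebraMap A R (v i), ?_⟩
    ext i
    simp [Matrix.mulVec, dotProduct, map_sum]
  · rw [Matrix.range_mulVecLin, Submodule.span_le]
    rintro _ ⟨j, rfl⟩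
    refine Submodule.subset_span ⟨L.mulVecLin (Pi.single j 1), ⟨_, rfl⟩, ?_⟩
    ext i
    simp

theorem Ideal.localized'_span_singleton {R : Type*} [CommRing R] [Algebra A R]
    (S : Submonoid A) [IsLocalization S R] (a : A) :
    Submodule.localized' R S (Algebra.linearMap A R) (Ideal.span {a}) =
      Ideal.span {algebraMap A R a} := by
  rw [Submodule.localized'_eq_span]
  apply le_antisymm
  · rw [Submodule.span_le]
    rintro _ ⟨x, hx, rfl⟩
    exact Ideal.mem_span_singleton.2 (map_dvd (algebraMap A R) (Ideal.mem_span_singleton.1 hx))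
  · exact Submodule.span_mono (Set.singleton_subset_iff.2
      ⟨a, Ideal.mem_span_singleton_self a, rfl⟩)

variable [IsDomain A] [UniqueFactorizationMonoid A] {q : A}
variable {M N P : Type*} [AddCommGroup M] [Module A M] [AddCommGroup N] [Module A N]
  [AddCommGroup P] [Module A P]

theorem localLength_eq_add_of_exact (f : M →ₗ[A] N) (g : N →ₗ[A] P) (hf : Function.Injective f)
    (hg : Function.Surjective g) (h : Function.Exact f g) :
    localLength q N = localLength q M + localLength q P :=
  Module.length_eq_add_of_exact (LocalizedModule.map (coprimeSubmonoid q) f)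
    (LocalizedModule.map (coprimeSubmonoid q) g)
    (LocalizedModule.map_injective _ f hf) (LocalizedModule.map_surjective _ g hg)
    (LocalizedModule.map_exact _ f g h)

theorem localLength_eq_length [Module (Localization (coprimeSubmonoid q)) N]
    [IsScalarTower A (Localization (coprimeSubmonoid q)) N] (f : M →ₗ[A] N)
    [IsLocalizedModule (coprimeSubmonoid q) f] :
    localLength q M = Module.length (Localization (coprimeSubmonoid q)) N :=
  ((IsLocalizedModule.iso (coprimeSubmonoid q) f).extendScalarsOfIsLocalization
    (coprimeSubmonoid q) (Localization (coprimeSubmonoid q))).length_eq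

theorem localLength_congr (e : M ≃ₗ[A] N) : localLength q M = localLength q N :=
  localLength_eq_length ((LocalizedModule.mkLinearMap (coprimeSubmonoid q) N).comp e.toLinearMap)

theorem localLength_quotient_span (a : A) : localLength q (A ⧸ Ideal.span {a}) = ordAt q a := by
  rw [localLength_eq_length (Submodule.toLocalizedQuotient' (Localization (coprimeSubmonoid q))
    (coprimeSubmonoid q) (Algebra.linearMap A (Localization (coprimeSubmonoid q)))
    (Ideal.span {a})), ordAt, Ring.ord,
    Ideal.localized'_span_singleton]

theorem isDomain_localization_coprimeSubmonoid (hq : ¬ IsUnit q) :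
    IsDomain (Localization (coprimeSubmonoid q)) :=
  IsLocalization.isDomain_localization (coprimeSubmonoid_le_nonZeroDivisors hq)

theorem algebraMap_coprimeSubmonoid_ne_zero (hq : ¬ IsUnit q) {a : A} (ha : a ≠ 0) :
    algebraMap A (Localization (coprimeSubmonoid q)) a ≠ 0 := by
  have := IsLocalization.injective (Localization (coprimeSubmonoid q))
    (coprimeSubmonoid_le_nonZeroDivisors hq)
  exact fun h => ha (this (by rw [h, map_zero]))

/-- Cokernels commute with localization, so this reduces to the determinant formula over the
localized ring, a principal ideal domain. -/
theorem localLength_quotient_range_mulVecLin (hq : Prime q) {ι : Type*} [Fintype ι]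
    [DecidableEq ι] (L : Matrix ι ι A) (hL : L.det ≠ 0) :
    localLength q ((ι → A) ⧸ LinearMap.range L.mulVecLin) = ordAt q L.det := by
  have := isDomain_localization_coprimeSubmonoid hq.not_isUnit
  have := isPrincipalIdealRing_of_coprimeSubmonoid (Localization (coprimeSubmonoid q)) hq.ne_zero
  have hdet : (L.map (algebraMap A (Localization (coprimeSubmonoid q)))).det =
      algebraMap A _ L.det := (RingHom.map_det _ _).symm
  rw [localLength_eq_length (Submodule.toLocalizedQuotient' (Localization (coprimeSubmonoid q))
    (coprimeSubmonoid q) (.pi fun i ↦ Algebra.linearMap A (Localization (coprimeSubmonoid q)) ∘ₗ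
      .proj i) (LinearMap.range L.mulVecLin)),
    Submodule.localized'_range_mulVecLin, Module.length_pi_quotient_range_mulVecLin, hdet, ordAt]
  rw [hdet]
  exact algebraMap_coprimeSubmonoid_ne_zero hq.not_isUnit hL

theorem localLength_prod : localLength q (M × N) = localLength q M + localLength q N :=
  localLength_eq_add_of_exact (LinearMap.inl A M N) (LinearMap.snd A M N) LinearMap.inl_injective
    LinearMap.snd_surjective .inl_snd

theorem localLength_pi {ι : Type*} [Fintype ι] (B : ι → Type*) [∀ i, AddCommGroup (B i)]
    [∀ i, Module A (B i)] : localLength q (∀ i, B i) = ∑ i, localLength q (B i) := by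
  rw [localLength_eq_length (.pi fun i ↦ LocalizedModule.mkLinearMap (coprimeSubmonoid q) (B i)
    ∘ₗ .proj i), Module.length_pi_of_fintype]
  rfl

/-- An annihilator prime to q becomes a unit in the localization; this is why pseudo-null modules
are invisible to local lengths. -/
theorem localLength_eq_zero {s : A} (hs : IsRelPrime s q) (h : ∀ x : M, s • x = 0) :
    localLength q M = 0 := by
  have : Subsingleton (LocalizedModule (coprimeSubmonoid q) M) :=
    LocalizedModule.subsingleton_iff.2 fun x => ⟨s, hs, h x⟩
  exact Module.length_eq_zero

theorem ordAt_mul (hq : ¬ IsUnit q) (a : A) {b : A} (hb : b ≠ 0) :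
    ordAt q (a * b) = ordAt q a + ordAt q b := by
  have := isDomain_localization_coprimeSubmonoid hq
  rw [ordAt, map_mul, Ring.ord_mul _ (mem_nonZeroDivisors_of_ne_zero
    (algebraMap_coprimeSubmonoid_ne_zero hq hb))]
  rfl

theorem ordAt_one : ordAt q (1 : A) = 0 := by
  rw [ordAt, map_one, Ring.ord_one]

theorem ordAt_pow (hq : ¬ IsUnit q) {a : A} (ha : a ≠ 0) (n : ℕ) :
    ordAt q (a ^ n) = n * ordAt q a := by
  induction n with
  | zero => simp [ordAt_one]
  | succ n ih => rw [pow_succ, ordAt_mul hq _ ha, ih]; push_cast; ring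

theorem ordAt_prod (hq : ¬ IsUnit q) {ι : Type*} (s : Finset ι) {a : ι → A}
    (ha : ∀ i ∈ s, a i ≠ 0) : ordAt q (∏ i ∈ s, a i) = ∑ i ∈ s, ordAt q (a i) := by
  classical
  induction s using Finset.induction_on with
  | empty => simp [ordAt_one]
  | insert i s hi ih =>
    rw [Finset.prod_insert hi, Finset.sum_insert hi, ordAt_mul hq, ih]
    · exact fun j hj => ha j (Finset.mem_insert_of_mem hj)
    · exact Finset.prod_ne_zero_iff.2 fun j hj => ha j (Finset.mem_insert_of_mem hj)

theorem ordAt_eq_emultiplicity (hq : Prime q) {a : A} (ha : a ≠ 0) :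
    ordAt q a = emultiplicity q a := by
  have := isDomain_localization_coprimeSubmonoid hq.not_isUnit
  have := isPrincipalIdealRing_of_coprimeSubmonoid (Localization (coprimeSubmonoid q)) hq.ne_zero
  have hfin : FiniteMultiplicity q a := FiniteMultiplicity.of_prime_left hq ha
  obtain ⟨c, hc, hqc⟩ := hfin.exists_eq_pow_mul_and_not_dvd
  have hc0 : c ≠ 0 := fun h => hqc (h ▸ dvd_zero q)
  have hcu : IsUnit (algebraMap A (Localization (coprimeSubmonoid q)) c) :=
    IsLocalization.map_units _ (⟨c, isRelPrime_of_prime_of_not_dvd hq hqc⟩ : coprimeSubmonoid q)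
  have hc1 : ordAt q c = 0 := Ring.ord_of_isUnit hcu
  have hq1 : ordAt q q = 1 :=
    Ring.ord_of_irreducible (irreducible_algebraMap_of_coprimeSubmonoid _ hq)
  rw [hfin.emultiplicity_eq_multiplicity]
  nth_rewrite 1 [hc]
  rw [ordAt_mul hq.not_isUnit _ hc0, ordAt_pow hq.not_isUnit hq.ne_zero, hc1, hq1]
  simp

/-- The order at q is the multiplicity of q, and in a factorial ring these multiplicities determine
an element up to units. Power series can thus be compared through local lengths alone. -/
theorem associated_of_ordAt_eq {a b : A} (ha : a ≠ 0) (hb : b ≠ 0)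
    (h : ∀ q : A, Prime q → ordAt q a = ordAt q b) : Associated a b := by
  have key : ∀ {a b : A}, a ≠ 0 → b ≠ 0 → (∀ q : A, Prime q → ordAt q a = ordAt q b) → a ∣ b := by
    intro a b ha hb h
    rw [UniqueFactorizationMonoid.dvd_iff_emultiplicity_le ha]
    intro q hq
    rw [← ordAt_eq_emultiplicity hq ha, ← ordAt_eq_emultiplicity hq hb, h q hq]
  exact associated_of_dvd_dvd (key ha hb h) (key hb ha fun q hq => (h q hq).symm)

end LocalLength

/-! ### Modules up to pseudo-isomorphism -/

section Structure

set_option linter.unusedSectionVars false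

variable {A : Type*} [CommRing A] [IsDomain A] [UniqueFactorizationMonoid A] [IsNoetherianRing A]
variable {M : Type*} [AddCommGroup M] [Module A M] [Module.Finite A M]

/-- Two modules with the same localization are related by maps φ, ψ in both directions, obtained by
clearing denominators. Both composites equal multiplication by s₁s₂ after a further multiplication
by some t₁ or t₂ in S, so t₁t₂s₁s₂ annihilates the kernel and the cokernel of φ. -/
theorem Module.exists_linearMap_of_isLocalizedModule (S : Submonoid A) {E N : Type*}
    [AddCommGroup E] [Module A E] [Module.Finite A E] [AddCommGroup N] [Module A N]
    (f : M →ₗ[A] N) (g : E →ₗ[A] N) [IsLocalizedModule S f] [IsLocalizedModule S g] :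
    ∃ (φ : M →ₗ[A] E) (s : A), s ∈ S ∧ (∀ x, φ x = 0 → s • x = 0) ∧
      ∀ y, ∃ x, φ x = s • y := by
  have := Module.finitePresentation_of_finite A M
  have := Module.finitePresentation_of_finite A E
  obtain ⟨φ, s₁, h₁⟩ := Module.FinitePresentation.exists_lift_of_isLocalizedModule S g f
  obtain ⟨ψ, s₂, h₂⟩ := Module.FinitePresentation.exists_lift_of_isLocalizedModule S f g
  have h₁' : ∀ x, g (φ x) = s₁ • f x := LinearMap.congr_fun h₁
  have h₂' : ∀ x, f (ψ x) = s₂ • g x := LinearMap.congr_fun h₂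
  obtain ⟨t₁, ht₁⟩ := Module.Finite.exists_smul_of_comp_eq_of_isLocalizedModule S f (ψ ∘ₗ φ)
    ((s₂ * s₁) • LinearMap.id) (by
      ext x
      change f (ψ (φ x)) = f ((s₂ * s₁) • x)
      rw [h₂', h₁', ← mul_smul, Submonoid.smul_def, Submonoid.smul_def, map_smul])
  obtain ⟨t₂, ht₂⟩ := Module.Finite.exists_smul_of_comp_eq_of_isLocalizedModule S g (φ ∘ₗ ψ)
    ((s₁ * s₂) • LinearMap.id) (by
      ext x
      change g (φ (ψ x)) = g ((s₁ * s₂) • x)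
      rw [h₁', h₂', ← mul_smul, Submonoid.smul_def, Submonoid.smul_def, map_smul])
  have ht₁' : ∀ x, t₁ • ψ (φ x) = t₁ • (s₂ * s₁) • x := LinearMap.congr_fun ht₁
  have ht₂' : ∀ x, t₂ • φ (ψ x) = t₂ • (s₁ * s₂) • x := LinearMap.congr_fun ht₂
  refine ⟨φ, (t₁ * t₂ * (s₁ * s₂) : S), Subtype.coe_prop _, fun x hx => ?_, fun y => ?_⟩
  · have h := ht₁' x
    rw [hx, map_zero, smul_zero] at h
    rw [← Submonoid.smul_def, show t₁ * t₂ * (s₁ * s₂) = t₂ * (t₁ * (s₂ * s₁)) by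
      simp only [mul_comm, mul_left_comm], mul_smul, mul_smul, ← h, smul_zero]
  · refine ⟨ψ (((t₁ * t₂ : S) : A) • y), ?_⟩
    rw [map_smul, map_smul, ← Submonoid.smul_def, ← Submonoid.smul_def, mul_smul, ht₂',
      ← mul_smul, ← mul_smul]

/-- The structure theorem for finitely generated torsion modules over a noetherian factorial
ring, up to pseudo-isomorphism. -/
theorem Module.exists_linearMap_pi_prime_pow {F : A} (hF : F ≠ 0) (hFu : ¬ IsUnit F)
    (hM : ∀ x : M, F • x = 0) :
    ∃ (n : ℕ) (q : Fin n → A) (e : Fin n → ℕ)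
      (φ : M →ₗ[A] ∀ i, A ⧸ Ideal.span {q i ^ e i}) (s : A),
      (∀ i, Prime (q i)) ∧ (∀ i, q i ∣ F) ∧ IsRelPrime s F ∧
      (∀ x, φ x = 0 → s • x = 0) ∧ ∀ y, ∃ x, φ x = s • y := by
  set S := coprimeSubmonoid F with hS
  let R := Localization S
  have : IsDomain R := IsLocalization.isDomain_localization
    (coprimeSubmonoid_le_nonZeroDivisors hFu)
  have : IsPrincipalIdealRing R := isPrincipalIdealRing_of_coprimeSubmonoid R hF
  have hF' : algebraMap A R F ≠ 0 := fun h => hF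
    (IsLocalization.injective R (coprimeSubmonoid_le_nonZeroDivisors hFu) (by rw [h, map_zero]))
  have htors : Module.IsTorsion R (LocalizedModule S M) := by
    intro x
    refine ⟨⟨algebraMap A R F, mem_nonZeroDivisors_of_ne_zero hF'⟩, ?_⟩
    induction x using LocalizedModule.induction_on with
    | h m s =>
      change algebraMap A R F • (LocalizedModule.mk m s : LocalizedModule S M) = 0
      rw [algebraMap_smul, LocalizedModule.smul'_mk, hM, LocalizedModule.zero_mk]
  have : Module.Finite R (LocalizedModule S M) :=
    Module.Finite.of_isLocalizedModule S (LocalizedModule.mkLinearMap S M)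
  obtain ⟨ι, _, r, hr, e, ⟨eqv⟩⟩ := Module.equiv_directSum_of_isTorsion htors
  classical
  -- The irreducible elements in the decomposition over the localization are replaced by associated
  -- prime factors of F in A, so that each summand is the localization of some A/(q^e).
  choose q hq hqF hqr using fun i =>
    Irreducible.exists_prime_associated_of_coprimeSubmonoid R hF (hr i)
  have heq : ∀ i, (R ∙ r i ^ e i) = Submodule.localized' R S (Algebra.linearMap A R)
      (Ideal.span {q i ^ e i}) := by
    intro i
    rw [Ideal.localized'_span_singleton, map_pow]
    exact Ideal.span_singleton_eq_span_singleton.2 ((hqr i).pow_pow)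
  let eqv' : LocalizedModule S M ≃ₗ[R] ∀ i, R ⧸ Submodule.localized' R S (Algebra.linearMap A R)
      (Ideal.span {q i ^ e i}) :=
    eqv.trans ((DirectSum.linearEquivFunOnFintype R ι _).trans
      (LinearEquiv.piCongrRight fun i => Submodule.quotEquivOfEq _ _ (heq i)))
  let f : M →ₗ[A] _ := (eqv'.restrictScalars A).toLinearMap ∘ₗ LocalizedModule.mkLinearMap S M
  let g : (∀ i, A ⧸ Ideal.span {q i ^ e i}) →ₗ[A] _ :=
    .pi fun i => Submodule.toLocalizedQuotient' R S (Algebra.linearMap A R)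
      (Ideal.span {q i ^ e i}) ∘ₗ .proj i
  have hf : IsLocalizedModule S f := IsLocalizedModule.of_linearEquiv S _ _
  have hg : IsLocalizedModule S g := inferInstance
  obtain ⟨φ, s, hs, h1, h2⟩ := Module.exists_linearMap_of_isLocalizedModule S f g
  let c := Fintype.equivFin ι
  let d := LinearEquiv.piCongrLeft' A (fun i => A ⧸ Ideal.span {q i ^ e i}) c
  refine ⟨Fintype.card ι, q ∘ c.symm, e ∘ c.symm, d.toLinearMap ∘ₗ φ, s, fun i => hq _,
    fun i => hqF _, hs, fun x hx => h1 x ?_, fun y => ?_⟩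
  · exact d.map_eq_zero_iff.1 hx
  · obtain ⟨x, hx⟩ := h2 (d.symm y)
    refine ⟨x, ?_⟩
    change d (φ x) = _
    rw [hx, map_smul, LinearEquiv.apply_symm_apply]

end Structure

/-! ### Divisibility by `ω_m` in `ℤ_p⟦T⟧` -/

namespace Iwasawa

variable {p : ℕ} [Fact p.Prime]

theorem coe_dvd_coe {a b : ℤ_[p][X]} (h : a ∣ b) : (a : ℤ_[p]⟦X⟧) ∣ (b : ℤ_[p]⟦X⟧) :=
  map_dvd (Polynomial.coeToPowerSeries.ringHom (R := ℤ_[p])) h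

theorem omega_dvd_omega_of_le {m n : ℕ} (h : m ≤ n) :
    (omega p m : ℤ_[p]⟦X⟧) ∣ (omega p n : ℤ_[p]⟦X⟧) := by
  refine coe_dvd_coe ?_
  induction n, h using Nat.le_induction with
  | base => exact dvd_rfl
  | succ n _ ih => exact ih.trans (omega_dvd_omega_succ n)

theorem coeff_zero_omega (m : ℕ) : (omega p m).coeff 0 = 0 := by
  simp [omega, Polynomial.coeff_zero_eq_eval_zero]

theorem coeff_omega_of_ne_zero (m : ℕ) {j : ℕ} (hj : j ≠ 0) :
    (omega p m).coeff j = ((p ^ m).choose j : ℤ_[p]) := by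
  rw [omega, Polynomial.coeff_sub, Polynomial.coeff_X_add_one_pow, Polynomial.coeff_one,
    if_neg hj, sub_zero]

/-- From j · C(p^m, j) = p^m · C(p^m - 1, j - 1) the binomial coefficient is divisible by p^{m-v},
with v the p-adic valuation of j. The crude bound v < p^v ≤ j ≤ N is enough. -/
theorem pow_dvd_choose_prime_pow {k N m j : ℕ} (hj : j ≠ 0) (hjN : j ≤ N) (hm : k + N ≤ m) :
    p ^ k ∣ (p ^ m).choose j := by
  have hp : p.Prime := Fact.out
  obtain ⟨v, c, hc, rfl⟩ := Nat.exists_eq_pow_mul_and_not_dvd hj p hp.ne_one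
  have hv : v ≤ N := by
    refine (Nat.lt_pow_self hp.one_lt).le.trans (le_trans ?_ hjN)
    exact Nat.le_mul_of_pos_right _ (Nat.pos_of_ne_zero fun h => hc (h ▸ dvd_zero p))
  obtain ⟨i, hi⟩ : ∃ i, p ^ v * c = i + 1 := Nat.exists_eq_succ_of_ne_zero hj
  obtain ⟨n, hn⟩ : ∃ n, p ^ m = n + 1 := Nat.exists_eq_succ_of_ne_zero (pow_pos hp.pos m).ne'
  have h1 : p ^ m ∣ (p ^ m).choose (p ^ v * c) * (p ^ v * c) := by
    rw [hi, hn, ← Nat.add_one_mul_choose_eq]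
    exact dvd_mul_right _ _
  have h2 : p ^ m = p ^ v * p ^ (m - v) := by rw [← pow_add]; congr 1; omega
  rw [h2, show ∀ x : ℕ, x * (p ^ v * c) = p ^ v * (c * x) by intro x; ring] at h1
  have h3 := Nat.dvd_of_mul_dvd_mul_left (pow_pos hp.pos v) h1
  have h4 : Nat.Coprime (p ^ (m - v)) c := Nat.Coprime.pow_left _ ((hp.coprime_iff_not_dvd).2 hc)
  rw [← h2] at h3
  exact (pow_dvd_pow p (by omega)).trans (h4.dvd_of_dvd_mul_left h3)

/-- The constant term of ω_m vanishes and its next N coefficients are binomial coefficients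
divisible by p^k. This estimate turns congruences modulo ω_m into p-adic closeness of coefficients.
-/
theorem pow_dvd_coeff_of_omega_dvd {k N m : ℕ} (hm : k + N ≤ m) {x : ℤ_[p]⟦X⟧}
    (hx : (omega p m : ℤ_[p]⟦X⟧) ∣ x) {j : ℕ} (hj : j ≤ N) :
    (p : ℤ_[p]) ^ k ∣ PowerSeries.coeff j x := by
  obtain ⟨y, rfl⟩ := hx
  rw [PowerSeries.coeff_mul]
  refine Finset.dvd_sum fun ij hij => Dvd.dvd.mul_right ?_ _
  rw [Polynomial.coeff_coe]
  by_cases h : ij.1 = 0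
  · rw [h, coeff_zero_omega]
    exact dvd_zero _
  · rw [coeff_omega_of_ne_zero _ h]
    have hle : ij.1 ≤ N := le_trans (le_of_le_of_eq (Nat.le_add_right _ _)
      (Finset.HasAntidiagonal.mem_antidiagonal.1 hij)) hj
    exact_mod_cast Nat.cast_dvd_cast (α := ℤ_[p]) (pow_dvd_choose_prime_pow h hle hm)

theorem eq_zero_of_forall_omega_dvd {x : ℤ_[p]⟦X⟧} (hx : ∀ m, (omega p m : ℤ_[p]⟦X⟧) ∣ x) :
    x = 0 := by
  ext j
  rw [map_zero]
  by_contra h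
  obtain ⟨n, hn⟩ := FiniteMultiplicity.of_prime_left (PadicInt.prime_p (p := p)) h
  exact hn (pow_dvd_coeff_of_omega_dvd le_rfl (hx _) le_rfl)

/-! ### Compactness of Λ and the powers (1+T)^a. -/

section Compactness

open scoped PowerSeries.WithPiTopology

theorem compactSpace_powerSeries : CompactSpace ℤ_[p]⟦X⟧ :=
  inferInstanceAs (CompactSpace ((Unit →₀ ℕ) → ℤ_[p]))

/-- Decreasing images of continuous maps on a compact space have a common point. -/
theorem exists_forall_exists_eq_add {ι : Type*} {Z : Type*} [TopologicalSpace Z] [CompactSpace Z]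
    [Nonempty Z] (f : ℕ → Z → ι → ℤ_[p]⟦X⟧) (hf : ∀ m, Continuous (f m))
    (hsub : ∀ m z, ∃ z', f m z' = f (m + 1) z) : ∃ y, ∀ m, ∃ z, f m z = y := by
  obtain ⟨y, hy⟩ := IsCompact.nonempty_iInter_of_sequence_nonempty_isCompact_isClosed
    (fun m => Set.range (f m)) (fun m => by rintro _ ⟨z, rfl⟩; exact hsub m z)
    (fun m => Set.range_nonempty _) (isCompact_range (hf 0))
    (fun m => (isCompact_range (hf m)).isClosed)
  exact ⟨y, fun m => Set.mem_iInter.1 hy m⟩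

end Compactness

theorem pow_sub_pow_dvd {m a b : ℕ} (h : (a : ZMod (p ^ m)) = b) :
    (omega p m : ℤ_[p]⟦X⟧) ∣
      (((Polynomial.X + 1) ^ a : ℤ_[p][X]) : ℤ_[p]⟦X⟧) - ((Polynomial.X + 1) ^ b : ℤ_[p][X]) := by
  wlog hab : b ≤ a generalizing a b
  · rw [← neg_sub]
    exact (dvd_neg).2 (this h.symm (le_of_not_ge hab))
  obtain ⟨c, rfl⟩ : ∃ c, a = b + p ^ m * c := by
    rw [ZMod.natCast_eq_natCast_iff] at h
    obtain ⟨c, hc⟩ := (Nat.modEq_iff_dvd' hab).1 h.symm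
    exact ⟨c, by omega⟩
  rw [← Polynomial.coe_sub]
  refine coe_dvd_coe ?_
  rw [pow_add, pow_mul, show ∀ u v : ℤ_[p][X], u * v - u = u * (v - 1) by intros; ring]
  exact (sub_one_dvd_pow_sub_one _ c).mul_left _

-- The cosets of ω_mΛ through (1+T)^k, where k is the representative of a modulo p^m in [0, p^m),
-- are compact and decrease with m; any common point serves as (1+T)^a.
open scoped PowerSeries.WithPiTopology in
theorem exists_onePlusTPow (a : ℤ_[p]) : ∃ u : ℤ_[p]⟦X⟧, ∀ m, (omega p m : ℤ_[p]⟦X⟧) ∣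
    u - ((Polynomial.X + 1) ^ (PadicInt.toZModPow m a).val : ℤ_[p][X]) := by
  have : CompactSpace ℤ_[p]⟦X⟧ := compactSpace_powerSeries
  obtain ⟨y, hy⟩ := exists_forall_exists_eq_add (p := p) (ι := Unit) (Z := ℤ_[p]⟦X⟧)
    (fun m z _ => (((Polynomial.X + 1) ^ (PadicInt.toZModPow m a).val : ℤ_[p][X]) : ℤ_[p]⟦X⟧) +
      (omega p m : ℤ_[p]⟦X⟧) * z)
    (fun m => by fun_prop) (fun m z => by
      have h1 : (omega p m : ℤ_[p]⟦X⟧) ∣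
          (((Polynomial.X + 1) ^ (PadicInt.toZModPow (m + 1) a).val : ℤ_[p][X]) : ℤ_[p]⟦X⟧) -
          ((Polynomial.X + 1) ^ (PadicInt.toZModPow m a).val : ℤ_[p][X]) := by
        refine pow_sub_pow_dvd ?_
        have : NeZero (p ^ m) := ⟨(pow_pos (Fact.out : p.Prime).pos m).ne'⟩
        have : NeZero (p ^ (m + 1)) := ⟨(pow_pos (Fact.out : p.Prime).pos (m + 1)).ne'⟩
        have h := DFunLike.congr_fun (PadicInt.zmod_cast_comp_toZModPow (p := p) m (m + 1) m.le_succ) a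
        rw [ZMod.natCast_zmod_val, ← h, RingHom.comp_apply, ZMod.castHom_apply,
          ZMod.natCast_val]
      obtain ⟨w, hw⟩ := h1
      obtain ⟨t, ht⟩ := omega_dvd_omega_of_le (p := p) m.le_succ
      refine ⟨w + t * z, ?_⟩
      funext _
      rw [Nat.succ_eq_add_one] at ht
      rw [ht, mul_add, ← hw]
      ring)
  refine ⟨y (), fun m => ?_⟩
  obtain ⟨z, hz⟩ := hy m
  exact ⟨z, by rw [← hz]; ring⟩

/-- The power `(1 + T)^a` for `a` in `ℤ_p`. -/
noncomputable def onePlusTPow (a : ℤ_[p]) : ℤ_[p]⟦X⟧ := (exists_onePlusTPow a).choose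

theorem omega_dvd_onePlusTPow_sub (a : ℤ_[p]) (m : ℕ) : (omega p m : ℤ_[p]⟦X⟧) ∣
    onePlusTPow a - ((Polynomial.X + 1) ^ (PadicInt.toZModPow m a).val : ℤ_[p][X]) :=
  (exists_onePlusTPow a).choose_spec m

theorem omega_dvd_onePlusTPow_sub_onePlusTPow {a b : ℤ_[p]} {m : ℕ}
    (h : PadicInt.toZModPow m a = PadicInt.toZModPow m b) :
    (omega p m : ℤ_[p]⟦X⟧) ∣ onePlusTPow a - onePlusTPow b := by
  have h1 := omega_dvd_onePlusTPow_sub a m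
  rw [h] at h1
  simpa using dvd_sub h1 (omega_dvd_onePlusTPow_sub b m)

/-! ### Newton shape of a power series -/

/-- `p^m` divides all coefficients of `H`, and `d` is the first index at which `p^(m+1)` does not
divide the coefficient of `H`. -/
def HasShape (H : ℤ_[p]⟦X⟧) (m d : ℕ) : Prop :=
  (∀ i, (p : ℤ_[p]) ^ m ∣ PowerSeries.coeff i H) ∧
    ¬ (p : ℤ_[p]) ^ (m + 1) ∣ PowerSeries.coeff d H ∧
    ∀ i < d, (p : ℤ_[p]) ^ (m + 1) ∣ PowerSeries.coeff i H

theorem HasShape.unique {H : ℤ_[p]⟦X⟧} {m d m' d' : ℕ} (h : HasShape H m d)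
    (h' : HasShape H m' d') : m = m' ∧ d = d' := by
  have key : ∀ {m d m' d' : ℕ}, HasShape H m d → HasShape H m' d' → m' ≤ m := by
    intro m d m' d' h h'
    by_contra hlt
    exact h.2.1 ((pow_dvd_pow _ (by omega)).trans (h'.1 d))
  obtain rfl : m = m' := le_antisymm (key h' h) (key h h')
  refine ⟨rfl, le_antisymm ?_ ?_⟩
  · by_contra hlt
    exact h'.2.1 (h.2.2 _ (by omega))
  · by_contra hlt
    exact h.2.1 (h'.2.2 _ (by omega))

/-- The bound on n makes the coefficients of index at most d agree modulo p^{m+1}. So p^{m+1} fails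
to divide the coefficient of H' at d and divides all earlier ones. -/
theorem HasShape.le_of_omega_dvd {H H' : ℤ_[p]⟦X⟧} {m d m' d' n : ℕ} (h : HasShape H m d)
    (h' : HasShape H' m' d') (hn : m + 1 + d ≤ n) (hd : (omega p n : ℤ_[p]⟦X⟧) ∣ H' - H) :
    m' ≤ m ∧ (m' = m → d' = d) := by
  have hc : ∀ i ≤ d, (p : ℤ_[p]) ^ (m + 1) ∣ PowerSeries.coeff i H' - PowerSeries.coeff i H := by
    intro i hi
    rw [← map_sub]
    exact pow_dvd_coeff_of_omega_dvd hn hd hi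
  have hd' : ¬ (p : ℤ_[p]) ^ (m + 1) ∣ PowerSeries.coeff d H' := fun hh =>
    h.2.1 ((dvd_sub_comm.1 (hc d le_rfl)) |> fun k => by simpa using dvd_add k hh)
  have hlt : ∀ i < d, (p : ℤ_[p]) ^ (m + 1) ∣ PowerSeries.coeff i H' := fun i hi => by
    simpa using dvd_add (hc i hi.le) (h.2.2 i hi)
  have hle : m' ≤ m := by
    by_contra hlt
    exact hd' ((pow_dvd_pow _ (by omega)).trans (h'.1 d))
  refine ⟨hle, ?_⟩
  rintro rfl
  refine le_antisymm ?_ ?_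
  · by_contra hh
    exact hd' (h'.2.2 _ (by omega))
  · by_contra hh
    exact h'.2.1 (hlt _ (by omega))

/-- The coefficients of H' up to index N remain divisible by p^m, hence by p^{m'+1}, so the first
one that is not must come after N. -/
theorem HasShape.lt_of_omega_dvd {H H' : ℤ_[p]⟦X⟧} {m d m' d' n N : ℕ} (h : HasShape H m d)
    (h' : HasShape H' m' d') (hn : m + N ≤ n) (hd : (omega p n : ℤ_[p]⟦X⟧) ∣ H' - H)
    (hm : m' < m) : N < d' := by
  by_contra hh
  refine h'.2.1 ((pow_dvd_pow (p : ℤ_[p]) (Nat.succ_le_of_lt hm)).trans ?_)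
  have := pow_dvd_coeff_of_omega_dvd hn hd (not_lt.1 hh)
  rw [map_sub] at this
  simpa using dvd_add this (h.1 d')

/-- After division by p^m one is left with G times a unit u. Modulo p the polynomial G is a power of
T, so the first coefficient not divisible by p has index deg G and is congruent to the constant term
of u. -/
theorem hasShape_of_associated {H : ℤ_[p]⟦X⟧} {G : ℤ_[p][X]} {m : ℕ}
    (hG : G.IsDistinguishedAt (IsLocalRing.maximalIdeal ℤ_[p]))
    (h : Associated H ((p : ℤ_[p]⟦X⟧) ^ m * (G : ℤ_[p]⟦X⟧))) : HasShape H m G.natDegree := by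
  obtain ⟨u, hu⟩ := h.symm
  have hp0 : (p : ℤ_[p]) ^ m ≠ 0 := pow_ne_zero _ (PadicInt.prime_p (p := p)).ne_zero
  have hcoeff : ∀ i, PowerSeries.coeff i H =
      (p : ℤ_[p]) ^ m * PowerSeries.coeff i ((G : ℤ_[p]⟦X⟧) * (u : ℤ_[p]⟦X⟧)) := by
    intro i
    have : (p : ℤ_[p]⟦X⟧) ^ m = PowerSeries.C ((p : ℤ_[p]) ^ m) := by simp
    rw [← hu, this, mul_assoc, PowerSeries.coeff_C_mul]
  have hlow : ∀ a < G.natDegree, (p : ℤ_[p]) ∣ G.coeff a := by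
    intro a ha
    have := hG.mem ha
    rwa [PadicInt.maximalIdeal_eq_span_p, Ideal.mem_span_singleton] at this
  refine ⟨fun i => ⟨_, hcoeff i⟩, ?_, fun i hi => ?_⟩
  · rw [hcoeff, pow_succ, mul_dvd_mul_iff_left hp0, PowerSeries.coeff_mul,
      ← Finset.add_sum_erase _ _ (a := (G.natDegree, 0)) (by simp)]
    intro hdvd
    have hrest : (p : ℤ_[p]) ∣ ∑ x ∈ (Finset.HasAntidiagonal.antidiagonal G.natDegree).erase (G.natDegree, 0),
        PowerSeries.coeff x.1 (G : ℤ_[p]⟦X⟧) * PowerSeries.coeff x.2 (u : ℤ_[p]⟦X⟧) := by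
      refine Finset.dvd_sum fun x hx => Dvd.dvd.mul_right ?_ _
      rw [Polynomial.coeff_coe]
      obtain ⟨hx1, hx2⟩ := Finset.mem_erase.1 hx
      refine hlow _ ?_
      have := Finset.HasAntidiagonal.mem_antidiagonal.1 hx2
      have hne : x.2 ≠ 0 := fun h0 => hx1 (by ext <;> simp <;> omega)
      omega
    have hlead := (dvd_add_left hrest).1 hdvd
    have hu0 : IsUnit (PowerSeries.coeff 0 (u : ℤ_[p]⟦X⟧)) := by
      rw [PowerSeries.coeff_zero_eq_constantCoeff]
      exact u.isUnit.map _
    rw [Polynomial.coeff_coe, hG.monic.coeff_natDegree, one_mul] at hlead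
    exact (PadicInt.prime_p (p := p)).not_isUnit (isUnit_of_dvd_unit hlead hu0)
  · rw [hcoeff, pow_succ, mul_dvd_mul_iff_left hp0, PowerSeries.coeff_mul]
    refine Finset.dvd_sum fun x hx => Dvd.dvd.mul_right ?_ _
    rw [Polynomial.coeff_coe]
    exact hlow _ (lt_of_le_of_lt (le_of_le_of_eq (Nat.le_add_right _ _)
      (Finset.HasAntidiagonal.mem_antidiagonal.1 hx)) hi)

/-! ### Reduction modulo p and Weierstrass preparation. -/

theorem p_dvd_iff_map_residue_eq_zero {c : ℤ_[p]⟦X⟧} :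
    (p : ℤ_[p]⟦X⟧) ∣ c ↔ c.map (IsLocalRing.residue ℤ_[p]) = 0 := by
  have hC : (p : ℤ_[p]⟦X⟧) = PowerSeries.C (p : ℤ_[p]) := by simp
  have hres : ∀ a : ℤ_[p], IsLocalRing.residue ℤ_[p] a = 0 ↔ (p : ℤ_[p]) ∣ a := by
    intro a
    rw [IsLocalRing.residue_eq_zero_iff, PadicInt.maximalIdeal_eq_span_p,
      Ideal.mem_span_singleton]
  constructor
  · rintro ⟨d, rfl⟩
    rw [map_mul, hC, PowerSeries.map_C, (hres _).2 dvd_rfl, map_zero, zero_mul]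
  · intro h
    have hdvd : ∀ i, (p : ℤ_[p]) ∣ PowerSeries.coeff i c := by
      intro i
      rw [← hres, ← PowerSeries.coeff_map, h, map_zero]
    choose d hd using hdvd
    refine ⟨PowerSeries.mk d, ?_⟩
    ext i
    rw [hC, PowerSeries.coeff_C_mul, PowerSeries.coeff_mk, hd]

theorem prime_p_powerSeries : Prime (p : ℤ_[p]⟦X⟧) := by
  refine ⟨?_, ?_, fun a b h => ?_⟩
  · intro h
    have := congrArg (PowerSeries.constantCoeff (R := ℤ_[p])) h
    rw [map_natCast, map_zero] at this
    exact (PadicInt.prime_p (p := p)).ne_zero this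
  · intro h
    have := h.map (PowerSeries.constantCoeff (R := ℤ_[p]))
    rw [map_natCast] at this
    exact (PadicInt.prime_p (p := p)).not_isUnit this
  · simpa only [p_dvd_iff_map_residue_eq_zero, map_mul, mul_eq_zero] using h

/-- Once the largest power of p is split off, the remaining factor is non-zero modulo p and the
Weierstrass factorization applies. -/
theorem exists_associated_distinguished {H : ℤ_[p]⟦X⟧} (hH : H ≠ 0) :
    ∃ (m : ℕ) (G : ℤ_[p][X]), G.IsDistinguishedAt (IsLocalRing.maximalIdeal ℤ_[p]) ∧
      Associated H ((p : ℤ_[p]⟦X⟧) ^ m * (G : ℤ_[p]⟦X⟧)) := by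
  have hfin : FiniteMultiplicity (p : ℤ_[p]⟦X⟧) H :=
    FiniteMultiplicity.of_prime_left prime_p_powerSeries hH
  obtain ⟨c, hc, hpc⟩ := hfin.exists_eq_pow_mul_and_not_dvd
  have hmap : c.map (IsLocalRing.residue ℤ_[p]) ≠ 0 := by
    rwa [Ne, ← p_dvd_iff_map_residue_eq_zero]
  obtain ⟨G, u, hGu⟩ := PowerSeries.exists_isWeierstrassFactorization hmap
  refine ⟨multiplicity (p : ℤ_[p]⟦X⟧) H, G, hGu.isDistinguishedAt, ?_⟩
  nth_rewrite 1 [hc]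
  refine Associated.mul_left _ ?_
  rw [hGu.eq_mul]
  exact (associated_mul_isUnit_left_iff hGu.isUnit).2 (Associated.refl _)

end Iwasawa

/-! ### The action of `ℤ_p⟦T⟧` on divisors of the derived graphs -/

namespace Iwasawa

variable {p : ℕ} [Fact p.Prime]

/-- A polynomial remainder modulo ω_m is also one modulo ω_n, as ω_n divides ω_m; the same
polynomial thus describes both actions. This yields the Λ-linearity of the degree, the projections,
the coordinates and the Laplacians from compatibility with T. -/
theorem action_intertwine {A B : Type*} [AddCommGroup A] [Module ℤ_[p] A] [AddCommGroup B]
    [Module ℤ_[p] B] {m n : ℕ} (hnm : n ≤ m) {σ : Module.End ℤ_[p] A} {τ : Module.End ℤ_[p] B}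
    (hσ : Polynomial.aeval σ (omega p m) = 0) (hτ : Polynomial.aeval τ (omega p n) = 0)
    (π : A →ₗ[ℤ_[p]] B) (h : ∀ x, π (σ x) = τ (π x)) (f : ℤ_[p]⟦X⟧) (x : A) :
    π (action m σ hσ f x) = action n τ hτ f (π x) := by
  obtain ⟨r, hr⟩ := exists_remainder m f
  rw [action_eq_aeval _ _ _ hr, action_eq_aeval _ _ _ ((omega_dvd_omega_of_le hnm).trans hr)]
  exact Multigraph.aeval_intertwine π h r x

theorem aeval_zero_omega_zero {A : Type*} [AddCommGroup A] [Module ℤ_[p] A] :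
    Polynomial.aeval (0 : Module.End ℤ_[p] A) (omega p 0) = 0 := by
  simp [omega]

/-- Here ω_0 = T, so only the constant term acts. This is the action on the target of the degree
map, on which the Galois group is trivial. -/
theorem action_zero_apply {A : Type*} [AddCommGroup A] [Module ℤ_[p] A] (f : ℤ_[p]⟦X⟧) (x : A) :
    action 0 (0 : Module.End ℤ_[p] A) aeval_zero_omega_zero f x =
      PowerSeries.constantCoeff f • x := by
  obtain ⟨r, hr⟩ := exists_remainder 0 f
  have h0 : PowerSeries.constantCoeff f = r.coeff 0 := by
    obtain ⟨y, hy⟩ := hr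
    have := congrArg (PowerSeries.constantCoeff (R := ℤ_[p])) hy
    rw [map_sub, map_mul, Polynomial.constantCoeff_coe, Polynomial.constantCoeff_coe,
      coeff_zero_omega, zero_mul, sub_eq_zero] at this
    exact this
  rw [action_eq_aeval _ _ _ hr, h0, ← Polynomial.coeff_zero_eq_aeval_zero']
  rfl

theorem aeval_X_eq_coe (r : ℤ_[p][X]) :
    Polynomial.aeval (PowerSeries.X : ℤ_[p]⟦X⟧) r = (r : ℤ_[p]⟦X⟧) := by
  induction r using Polynomial.induction_on' with
  | add a b ha hb => rw [map_add, ha, hb, Polynomial.coe_add]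
  | monomial n a =>
    rw [Polynomial.aeval_monomial, Polynomial.coe_monomial, PowerSeries.algebraMap_apply,
      Algebra.algebraMap_self, RingHom.id_apply]
    ext i
    rw [PowerSeries.coeff_C_mul, PowerSeries.coeff_X_pow, PowerSeries.coeff_monomial]
    simp

theorem aeval_mk_X (m : ℕ) (r : ℤ_[p][X]) :
    Polynomial.aeval (Ideal.Quotient.mk (Ideal.span {(omega p m : ℤ_[p]⟦X⟧)}) PowerSeries.X) r =
      Ideal.Quotient.mk _ (r : ℤ_[p]⟦X⟧) := by
  have h := Polynomial.aeval_algHom_apply (Ideal.Quotient.mkₐ ℤ_[p]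
    (Ideal.span {(omega p m : ℤ_[p]⟦X⟧)})) PowerSeries.X r
  rwa [aeval_X_eq_coe] at h

theorem aeval_lmul_omega (m : ℕ) :
    Polynomial.aeval (Algebra.lmul ℤ_[p] (ℤ_[p]⟦X⟧ ⧸ Ideal.span {(omega p m : ℤ_[p]⟦X⟧)})
      (Ideal.Quotient.mk _ PowerSeries.X)) (omega p m) = 0 := by
  rw [Polynomial.aeval_algHom_apply]
  have : Polynomial.aeval (Ideal.Quotient.mk (Ideal.span {(omega p m : ℤ_[p]⟦X⟧)})
      PowerSeries.X) (omega p m) = 0 := by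
    rw [aeval_mk_X]
    exact Ideal.Quotient.eq_zero_iff_mem.2 (Ideal.mem_span_singleton_self _)
  rw [this, map_zero]

theorem action_lmul_apply (m : ℕ) (f : ℤ_[p]⟦X⟧)
    (x : ℤ_[p]⟦X⟧ ⧸ Ideal.span {(omega p m : ℤ_[p]⟦X⟧)}) :
    action m _ (aeval_lmul_omega m) f x = Ideal.Quotient.mk _ f * x := by
  obtain ⟨r, hr⟩ := exists_remainder m f
  rw [action_eq_aeval _ _ _ hr, Polynomial.aeval_algHom_apply, aeval_mk_X,
    Ideal.Quotient.eq.2 (Ideal.mem_span_singleton.2 hr)]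
  rfl

theorem omega_dvd_X_mul_add (m k : ℕ) (g : ZMod (p ^ m)) (h : (k : ZMod (p ^ m)) = g + 1) :
    (omega p m : ℤ_[p]⟦X⟧) ∣ (((Polynomial.X + 1) ^ k : ℤ_[p][X]) : ℤ_[p]⟦X⟧) -
      (1 + PowerSeries.X : ℤ_[p]⟦X⟧) * (((Polynomial.X + 1) ^ g.val : ℤ_[p][X]) : ℤ_[p]⟦X⟧) := by
  have hp : NeZero (p ^ m) := ⟨(pow_pos (Fact.out : p.Prime).pos m).ne'⟩
  have h2 : (1 + PowerSeries.X : ℤ_[p]⟦X⟧) * (((Polynomial.X + 1) ^ g.val : ℤ_[p][X]) : ℤ_[p]⟦X⟧) =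
      ((Polynomial.X + 1) ^ (g.val + 1) : ℤ_[p][X]) := by
    rw [pow_succ', Polynomial.coe_mul, Polynomial.coe_add, Polynomial.coe_X, Polynomial.coe_one,
      add_comm]
  rw [h2]
  refine pow_sub_pow_dvd ?_
  rw [h, Nat.cast_add, ZMod.natCast_zmod_val, Nat.cast_one]

end Iwasawa

namespace Multigraph

open Iwasawa

variable {V E : Type*} {p : ℕ} [Fact p.Prime]

theorem Div.hom_ext {R : Type*} [CommRing R] {N : Type*} [AddCommGroup N] [Module R N]
    {f g : Div R V →ₗ[R] N} (h : ∀ v, f (Div.of v) = g (Div.of v)) : f = g :=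
  Finsupp.lhom_ext' fun v => LinearMap.ext_ring (h v)

theorem Div.span_range_of (R : Type*) [CommRing R] (V : Type*) :
    Submodule.span R (Set.range (Div.of : V → Div R V)) = ⊤ := by
  have h : (Submodule.span R (Set.range (Div.of : V → Div R V))).mkQ = 0 := by
    refine Div.hom_ext fun v => ?_
    exact (Submodule.Quotient.mk_eq_zero _).2 (Submodule.subset_span ⟨v, rfl⟩)
  rw [← Submodule.ker_mkQ (Submodule.span R (Set.range (Div.of : V → Div R V))), h,
    LinearMap.ker_zero]

/-- The linear map on divisors with prescribed values at the vertices. -/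
noncomputable def Div.lift {R : Type*} [CommRing R] {N : Type*} [AddCommGroup N] [Module R N]
    (f : V → N) : Div R V →ₗ[R] N :=
  Finsupp.linearCombination R f

theorem Div.lift_of {R : Type*} [CommRing R] {N : Type*} [AddCommGroup N] [Module R N]
    (f : V → N) (v : V) : Div.lift f (Div.of v : Div R V) = f v := by
  exact (Finsupp.linearCombination_single R 1 v).trans (one_smul R _)

theorem Div.range_lift {R : Type*} [CommRing R] {N : Type*} [AddCommGroup N] [Module R N]
    (f : V → N) : LinearMap.range (Div.lift f : Div R V →ₗ[R] N) =
      Submodule.span R (Set.range f) :=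
  Finsupp.range_linearCombination R

theorem degree_of {R : Type*} [CommRing R] (v : V) : degree R V (Div.of v) = 1 :=
  Div.lift_of (fun _ => (1 : R)) v

section Level

set_option linter.unusedSectionVars false

variable (p V) in
/-- The action of the generator `1` of `ℤ/p^mℤ` on the divisors of `X_m`. -/
noncomputable def divShift (m : ℕ) : Module.End ℤ_[p] (Div ℤ_[p] (V × ZMod (p ^ m))) :=
  Div.map ℤ_[p] (shift p V m)

theorem divShift_of (m : ℕ) (w : V × ZMod (p ^ m)) :
    divShift V p m (Div.of w) = Div.of (w.1, w.2 + 1) :=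
  Div.map_of _ _ _

theorem divShift_pow_of (m k : ℕ) (w : V × ZMod (p ^ m)) :
    (divShift V p m ^ k) (Div.of w) = Div.of (w.1, w.2 + k) := by
  induction k with
  | zero => simp
  | succ k ih =>
    rw [pow_succ', Module.End.mul_apply, ih, divShift_of]
    push_cast
    rw [add_assoc]

theorem aeval_divShift (m : ℕ) :
    Polynomial.aeval (divShift V p m - 1) (omega p m) = 0 := by
  have : divShift V p m ^ p ^ m = 1 := by
    refine Div.hom_ext fun w => ?_
    rw [divShift_pow_of, ZMod.natCast_self, add_zero]
    rfl
  simp [omega, this]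

variable (p V) in
/-- The action of `ℤ_p⟦T⟧` on the divisors of `X_m`. -/
noncomputable def divAction (m : ℕ) :
    ℤ_[p]⟦X⟧ →ₐ[ℤ_[p]] Module.End ℤ_[p] (Div ℤ_[p] (V × ZMod (p ^ m))) :=
  action m (divShift V p m - 1) (aeval_divShift m)

theorem divAction_eq_zero {m : ℕ} {f : ℤ_[p]⟦X⟧} (h : (omega p m : ℤ_[p]⟦X⟧) ∣ f) :
    divAction V p m f = 0 := by
  rw [divAction, action_eq_aeval _ _ _ (r := 0) (by simpa using h), map_zero]

theorem divAction_of {m k : ℕ} {f : ℤ_[p]⟦X⟧}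
    (h : (omega p m : ℤ_[p]⟦X⟧) ∣ f - ((Polynomial.X + 1) ^ k : ℤ_[p][X])) (w : V × ZMod (p ^ m)) :
    divAction V p m f (Div.of w) = Div.of (w.1, w.2 + k) := by
  rw [divAction, action_eq_aeval _ _ _ h, ← divShift_pow_of]
  simp

theorem divAction_onePlusTPow_of (m : ℕ) (a : ℤ_[p]) (w : V × ZMod (p ^ m)) :
    divAction V p m (onePlusTPow a) (Div.of w) =
      Div.of (w.1, w.2 + PadicInt.toZModPow m a) := by
  have hp : NeZero (p ^ m) := ⟨(pow_pos (Fact.out : p.Prime).pos m).ne'⟩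
  rw [divAction_of (omega_dvd_onePlusTPow_sub a m), ZMod.natCast_zmod_val]

theorem divAction_X (m : ℕ) : divAction V p m PowerSeries.X = divShift V p m - 1 := by
  rw [divAction, action_eq_aeval _ _ _ (r := Polynomial.X) (by simp), Polynomial.aeval_X]

theorem degree_divAction (m : ℕ) (f : ℤ_[p]⟦X⟧) (d : Div ℤ_[p] (V × ZMod (p ^ m))) :
    degree ℤ_[p] _ (divAction V p m f d) =
      PowerSeries.constantCoeff f * degree ℤ_[p] _ d := by
  rw [divAction, action_intertwine (Nat.zero_le m) _ aeval_zero_omega_zero, action_zero_apply,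
    smul_eq_mul]
  intro d
  change degree ℤ_[p] _ (Div.map ℤ_[p] _ d - d) = 0
  rw [map_sub, degree_mapDomain, sub_self]

theorem map_proj_divAction (m : ℕ) (f : ℤ_[p]⟦X⟧) (d : Div ℤ_[p] (V × ZMod (p ^ (m + 1)))) :
    Div.map ℤ_[p] (proj p V m) (divAction V p (m + 1) f d) =
      divAction V p m f (Div.map ℤ_[p] (proj p V m) d) := by
  refine action_intertwine m.le_succ _ _ _ (fun d => ?_) f d
  rw [LinearMap.sub_apply, LinearMap.sub_apply, map_sub]
  change Div.map ℤ_[p] _ (Div.map ℤ_[p] _ d) - Div.map ℤ_[p] _ d =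
    Div.map ℤ_[p] _ (Div.map ℤ_[p] _ d) - Div.map ℤ_[p] _ d
  rw [Div.map_map, Div.map_map]
  congr 3
  funext w
  simp only [Function.comp, shift, proj, map_add, map_one]

/-! ### The divisors of X_m as (Λ/ω_m)^V. -/

variable [Fintype V]

open scoped Classical in
variable (p V) in
/-- The map `ℤ_p⟦T⟧^V → Div(X_m)` of `ℤ_p⟦T⟧`-modules that sends the basis vector at `v` to
the vertex `(v, 0)`. -/
noncomputable def theta (m : ℕ) : (V → ℤ_[p]⟦X⟧) →ₗ[ℤ_[p]] Div ℤ_[p] (V × ZMod (p ^ m)) :=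
  ∑ v, (divAction V p m).toLinearMap.flip (Div.of (v, 0)) ∘ₗ LinearMap.proj v

theorem theta_apply (m : ℕ) (y : V → ℤ_[p]⟦X⟧) :
    theta V p m y = ∑ v, divAction V p m (y v) (Div.of (v, 0)) := by
  simp [theta]

theorem theta_smul (m : ℕ) (f : ℤ_[p]⟦X⟧) (y : V → ℤ_[p]⟦X⟧) :
    theta V p m (f • y) = divAction V p m f (theta V p m y) := by
  simp [theta_apply]

open scoped Classical in
theorem theta_single (m : ℕ) (v : V) (f : ℤ_[p]⟦X⟧) :
    theta V p m (Pi.single v f) = divAction V p m f (Div.of (v, 0)) := by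
  rw [theta_apply, Finset.sum_eq_single v]
  · rw [Pi.single_eq_same]
  · intro w _ hw
    rw [Pi.single_eq_of_ne hw, map_zero, LinearMap.zero_apply]
  · simp

theorem theta_surjective (m : ℕ) : Function.Surjective (theta V p m) := by
  classical
  have hp : NeZero (p ^ m) := ⟨(pow_pos (Fact.out : p.Prime).pos m).ne'⟩
  rw [← LinearMap.range_eq_top, eq_top_iff, ← Div.span_range_of, Submodule.span_le]
  rintro _ ⟨⟨v, g⟩, rfl⟩
  refine ⟨Pi.single v (((Polynomial.X + 1) ^ g.val : ℤ_[p][X]) : ℤ_[p]⟦X⟧), ?_⟩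
  rw [theta_single, divAction_of (k := g.val) (by simp)]
  simp

theorem degree_theta (m : ℕ) (y : V → ℤ_[p]⟦X⟧) :
    degree ℤ_[p] _ (theta V p m y) = ∑ v, PowerSeries.constantCoeff (y v) := by
  simp only [theta_apply, map_sum, degree_divAction, degree_of, mul_one]

theorem map_proj_theta (m : ℕ) (y : V → ℤ_[p]⟦X⟧) :
    Div.map ℤ_[p] (proj p V m) (theta V p (m + 1) y) = theta V p m y := by
  simp only [theta_apply, map_sum, map_proj_divAction, Div.map_of, proj, map_zero]

open scoped Classical in
/-- The coordinate at `v` of divisors of `X_m`, considered as elements of `(ℤ_p⟦T⟧/(ω_m))^V`. -/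
noncomputable def divCoord (m : ℕ) (v : V) :
    Div ℤ_[p] (V × ZMod (p ^ m)) →ₗ[ℤ_[p]] ℤ_[p]⟦X⟧ ⧸ Ideal.span {(omega p m : ℤ_[p]⟦X⟧)} :=
  Div.lift fun w => if w.1 = v then
    Ideal.Quotient.mk _ (((Polynomial.X + 1) ^ w.2.val : ℤ_[p][X]) : ℤ_[p]⟦X⟧) else 0

theorem divCoord_divAction (m : ℕ) (v : V) (f : ℤ_[p]⟦X⟧) (d : Div ℤ_[p] (V × ZMod (p ^ m))) :
    divCoord m v (divAction V p m f d) = Ideal.Quotient.mk _ f * divCoord m v d := by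
  have hp : NeZero (p ^ m) := ⟨(pow_pos (Fact.out : p.Prime).pos m).ne'⟩
  rw [← action_lmul_apply]
  refine action_intertwine le_rfl _ _ _ (fun d => ?_) f d
  refine LinearMap.congr_fun (f := divCoord m v ∘ₗ (divShift V p m - 1))
    (g := Algebra.lmul ℤ_[p] _ (Ideal.Quotient.mk _ PowerSeries.X) ∘ₗ divCoord m v)
    (Div.hom_ext fun w => ?_) d
  simp only [LinearMap.comp_apply, LinearMap.sub_apply, divShift_of, Module.End.one_apply, map_sub,
    divCoord, Div.lift_of, Algebra.coe_lmul_eq_mul, LinearMap.mul_apply']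
  split_ifs
  · rw [sub_eq_iff_eq_add, ← map_mul, ← map_add, Ideal.Quotient.eq, Ideal.mem_span_singleton]
    have := omega_dvd_X_mul_add (p := p) m (w.2 + 1).val w.2 (ZMod.natCast_zmod_val _)
    rw [one_add_mul] at this
    rwa [add_comm (PowerSeries.X * _)]
  · simp

/-- The coordinate maps are compatible with multiplication by Λ and send (v, 0) to 1 or 0, so they
recover y modulo ω_m from its image. -/
theorem omega_dvd_of_theta_eq_zero {m : ℕ} {y : V → ℤ_[p]⟦X⟧} (h : theta V p m y = 0) (v : V) :
    (omega p m : ℤ_[p]⟦X⟧) ∣ y v := by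
  have h1 := congrArg (divCoord m v) h
  rw [map_zero, theta_apply, map_sum, Finset.sum_eq_single v] at h1
  · rw [divCoord_divAction, divCoord, Div.lift_of, if_pos rfl] at h1
    rw [ZMod.val_zero, pow_zero, Polynomial.coe_one, map_one, mul_one] at h1
    exact Ideal.mem_span_singleton.1 (Ideal.Quotient.eq_zero_iff_mem.1 h1)
  · intro w _ hw
    rw [divCoord_divAction, divCoord, Div.lift_of, if_neg hw, mul_zero]
  · simp

theorem theta_eq_zero_iff {m : ℕ} {y : V → ℤ_[p]⟦X⟧} :
    theta V p m y = 0 ↔ ∃ z, y = (omega p m : ℤ_[p]⟦X⟧) • z := by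
  constructor
  · intro h
    choose z hz using omega_dvd_of_theta_eq_zero h
    exact ⟨z, funext hz⟩
  · rintro ⟨z, rfl⟩
    rw [theta_smul, divAction_eq_zero dvd_rfl, LinearMap.zero_apply]

end Level

end Multigraph

/-! ### The voltage Laplacian -/

namespace Multigraph

open Iwasawa

/-! ### The Laplacian of a single multigraph and its kernel. -/

section FiringMap

set_option linter.unusedSectionVars false

variable {V E : Type*} [Fintype E]

/-- The Laplacian, as an endomorphism of the module of divisors. -/
noncomputable def firingMap (R : Type*) [CommRing R] (Y : Multigraph V E) :
    Div R V →ₗ[R] Div R V :=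
  Div.lift (Y.firing R)

theorem firingMap_of (R : Type*) [CommRing R] (Y : Multigraph V E) (v : V) :
    Y.firingMap R (Div.of v) = Y.firing R v :=
  Div.lift_of _ _

theorem range_firingMap (R : Type*) [CommRing R] (Y : Multigraph V E) :
    LinearMap.range (Y.firingMap R) = Y.principal R :=
  Div.range_lift _

theorem degree_firingMap (R : Type*) [CommRing R] (Y : Multigraph V E) (d : Div R V) :
    degree R V (Y.firingMap R d) = 0 := by
  classical
  refine LinearMap.congr_fun (f := degree R V ∘ₗ Y.firingMap R) (g := 0)
    (Div.hom_ext fun v => ?_) d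
  rw [LinearMap.comp_apply, firingMap_of, firing, LinearMap.zero_apply]
  simp only [map_neg, map_add, map_sum]
  rw [Finset.sum_eq_zero, Finset.sum_eq_zero, add_zero, neg_zero] <;>
  · intro e _
    split_ifs
    · rw [map_sub, degree_of, degree_of, sub_self]
    · exact map_zero _

/-- The coefficient of a divisor at a vertex. -/
noncomputable def Div.coeff {R : Type*} [CommRing R] (v : V) : Div R V →ₗ[R] R :=
  Finsupp.lapply v

open scoped Classical in
theorem Div.coeff_of {R : Type*} [CommRing R] (v w : V) :
    Div.coeff v (Div.of w : Div R V) = if w = v then 1 else 0 := by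
  exact Finsupp.single_apply

theorem Div.ext {R : Type*} [CommRing R] {d d' : Div R V}
    (h : ∀ v, Div.coeff v d = Div.coeff v d') : d = d' :=
  Finsupp.ext h

/-- The Laplacian as a sum over edges, each contributing its boundary times the difference of the
coefficients at its ends. This is the form that the energy argument needs. -/
theorem firingMap_apply (R : Type*) [CommRing R] (Y : Multigraph V E) (d : Div R V) :
    Y.firingMap R d = ∑ e, (Div.coeff (Y.src e) d - Div.coeff (Y.tgt e) d) •
      (Div.of (Y.src e) - Div.of (Y.tgt e)) := by
  classical
  let g : Div R V →ₗ[R] Div R V := ∑ e,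
    LinearMap.smulRight (Div.coeff (Y.src e) - Div.coeff (Y.tgt e) : Div R V →ₗ[R] R)
    (Div.of (Y.src e) - Div.of (Y.tgt e))
  have hg : ∀ d, g d = ∑ e, (Div.coeff (Y.src e) d - Div.coeff (Y.tgt e) d) •
      (Div.of (Y.src e) - Div.of (Y.tgt e)) := by
    intro d
    simp [g]
  rw [← hg]
  refine LinearMap.congr_fun (Div.hom_ext fun v => ?_) d
  rw [hg, firingMap_of, firing, ← Finset.sum_add_distrib, ← Finset.sum_neg_distrib]
  refine Finset.sum_congr rfl fun e _ => ?_
  rw [Div.coeff_of, Div.coeff_of]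
  by_cases h1 : Y.src e = v <;> by_cases h2 : Y.tgt e = v
  · simp [h1, h2]
  · simp [h1, h2, Ne.symm h2]
  · simp [h1, h2, Ne.symm h1]
  · simp [h1, h2, Ne.symm h1, Ne.symm h2]

theorem Connected.eq_of_forall_edge {Y : Multigraph V E} (hY : Y.Connected) {B : Type*}
    {c : V → B} (h : ∀ e, c (Y.src e) = c (Y.tgt e)) (v w : V) : c v = c w := by
  obtain ⟨W⟩ := hY.preconnected v w
  induction W with
  | nil => rfl
  | cons hadj _ ih =>
    rw [← ih]
    rw [SimpleGraph.fromRel_adj] at hadj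
    obtain ⟨-, ⟨e, rfl, rfl⟩ | ⟨e, rfl, rfl⟩⟩ := hadj
    · exact h e
    · exact (h e).symm

variable [Fintype V] {p : ℕ} [Fact p.Prime]

-- Pairing the Laplacian of d with d gives the sum of squared differences along the edges, but
-- squares in ℤ_p have no positivity. As the Laplacian has integral entries, it commutes with any
-- additive map l to ℚ, and the energy of the rational-valued function obtained from d is a
-- vanishing sum of squares.
open scoped Classical in
theorem map_coeff_eq_of_firingMap_eq_zero {Y : Multigraph V E} {d : Div ℤ_[p] V}
    (hd : Y.firingMap ℤ_[p] d = 0) (l : ℤ_[p] →+ ℚ) (e : E) :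
    l (Div.coeff (Y.src e) d - Div.coeff (Y.tgt e) d) = 0 := by
  have h1 : ∀ u, ∑ e, ((if Y.src e = u then l (Div.coeff (Y.src e) d - Div.coeff (Y.tgt e) d)
      else 0) - if Y.tgt e = u then l (Div.coeff (Y.src e) d - Div.coeff (Y.tgt e) d) else 0) =
      0 := by
    intro u
    have h := congrArg (fun x => l (Div.coeff u x)) hd
    simp only [firingMap_apply, map_sum, map_smul, map_zero, Div.coeff_of, smul_eq_mul,
      mul_sub, mul_ite, mul_one, mul_zero, map_sub (Div.coeff u)] at h
    refine Eq.trans (Finset.sum_congr rfl fun e _ => ?_) h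
    split_ifs <;> simp
  have h2 : ∑ u, l (Div.coeff u d) * ∑ e, ((if Y.src e = u then
      l (Div.coeff (Y.src e) d - Div.coeff (Y.tgt e) d) else 0) - if Y.tgt e = u then
      l (Div.coeff (Y.src e) d - Div.coeff (Y.tgt e) d) else 0) = 0 :=
    Finset.sum_eq_zero fun u _ => by rw [h1, mul_zero]
  simp only [Finset.mul_sum] at h2
  rw [Finset.sum_comm] at h2
  have h3 : ∀ e, ∑ u, l (Div.coeff u d) * ((if Y.src e = u then
      l (Div.coeff (Y.src e) d - Div.coeff (Y.tgt e) d) else 0) - if Y.tgt e = u then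
      l (Div.coeff (Y.src e) d - Div.coeff (Y.tgt e) d) else 0) =
      l (Div.coeff (Y.src e) d - Div.coeff (Y.tgt e) d) *
        l (Div.coeff (Y.src e) d - Div.coeff (Y.tgt e) d) := by
    intro e
    simp only [mul_sub, Finset.sum_sub_distrib, mul_ite, mul_zero, Finset.sum_ite_eq,
      Finset.mem_univ, if_true]
    nth_rewrite 4 [map_sub]
    ring
  simp only [h3] at h2
  rw [Finset.sum_eq_zero_iff_of_nonneg fun _ _ => mul_self_nonneg _] at h2
  exact mul_self_eq_zero.1 (h2 e (Finset.mem_univ e))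

/-- On a connected multigraph, the kernel of the Laplacian consists of the constant divisors. -/
theorem Connected.coeff_eq_of_firingMap_eq_zero {Y : Multigraph V E} (hY : Y.Connected)
    {d : Div ℤ_[p] V} (hd : Y.firingMap ℤ_[p] d = 0) (v w : V) :
    Div.coeff v d = Div.coeff w d := by
  refine hY.eq_of_forall_edge (c := fun v => Div.coeff v d) (fun e => ?_) v w
  rw [← sub_eq_zero]
  -- Over ℚ the linear functionals on ℚ_p separate points, so the rational-valued statement for all
  -- l suffices.
  have h : ((Div.coeff (Y.src e) d - Div.coeff (Y.tgt e) d : ℤ_[p]) : ℚ_[p]) = 0 := by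
    rw [← Module.forall_dual_apply_eq_zero_iff ℚ]
    intro f
    exact map_coeff_eq_of_firingMap_eq_zero hd
      (f.toAddMonoidHom.comp (PadicInt.Coe.ringHom (p := p)).toAddMonoidHom) e
  exact Subtype.ext (h.trans PadicInt.coe_zero.symm)

end FiringMap

/-! ### The Laplacian over Λ and its reductions to the layers X_m. -/

section Laplacian

set_option linter.unusedSectionVars false

variable {V E : Type*} [Fintype E] {p : ℕ} [Fact p.Prime]

open scoped Classical in
/-- The column at `v` of the voltage Laplacian. -/
noncomputable def lapCol (X : Multigraph V E) (α : E → ℤ_[p]) (v : V) : V → ℤ_[p]⟦X⟧ :=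
  ∑ e, ((if X.src e = v then Pi.single v 1 - Pi.single (X.tgt e) (onePlusTPow (α e)) else 0) +
    if X.tgt e = v then Pi.single v 1 - Pi.single (X.src e) (onePlusTPow (-α e)) else 0)

/-- The voltage Laplacian, a matrix with entries in `ℤ_p⟦T⟧`. -/
noncomputable def lap (X : Multigraph V E) (α : E → ℤ_[p]) : Matrix V V ℤ_[p]⟦X⟧ :=
  Matrix.of fun w v => X.lapCol α v w

theorem omega_dvd_lap_sub (X : Multigraph V E) {α β : E → ℤ_[p]} {m : ℕ}
    (h : ∀ e, PadicInt.toZModPow m (α e) = PadicInt.toZModPow m (β e)) (v w : V) :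
    (omega p m : ℤ_[p]⟦X⟧) ∣ X.lap α w v - X.lap β w v := by
  classical
  have key : ∀ {a b : ℤ_[p]}, PadicInt.toZModPow m a = PadicInt.toZModPow m b → ∀ u : V,
      (omega p m : ℤ_[p]⟦X⟧) ∣ (Pi.single v 1 - Pi.single u (onePlusTPow a) : V → ℤ_[p]⟦X⟧) w -
        (Pi.single v 1 - Pi.single u (onePlusTPow b) : V → ℤ_[p]⟦X⟧) w := by
    intro a b hab u
    rw [Pi.sub_apply, Pi.sub_apply, sub_sub_sub_cancel_left]
    by_cases hu : w = u
    · subst hu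
      rw [Pi.single_eq_same, Pi.single_eq_same]
      exact omega_dvd_onePlusTPow_sub_onePlusTPow hab.symm
    · rw [Pi.single_eq_of_ne hu, Pi.single_eq_of_ne hu, sub_self]
      exact dvd_zero _
  simp only [lap, Matrix.of_apply, lapCol, Finset.sum_apply]
  rw [← Finset.sum_sub_distrib]
  refine Finset.dvd_sum fun e _ => ?_
  rw [Pi.add_apply, Pi.add_apply, add_sub_add_comm]
  refine dvd_add ?_ ?_
  · split_ifs
    · convert key (h e) (X.tgt e)
    · simp
  · split_ifs
    · convert key (a := -α e) (b := -β e) (by rw [map_neg, map_neg, h e]) (X.src e)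
    · simp

variable [Fintype V]

theorem omega_dvd_det_lap_sub [DecidableEq V] (X : Multigraph V E) {α β : E → ℤ_[p]} {m : ℕ}
    (h : ∀ e, PadicInt.toZModPow m (α e) = PadicInt.toZModPow m (β e)) :
    (omega p m : ℤ_[p]⟦X⟧) ∣ (X.lap α).det - (X.lap β).det := by
  set π := Ideal.Quotient.mk (Ideal.span {(omega p m : ℤ_[p]⟦X⟧)})
  have hmap : π.mapMatrix (X.lap α) = π.mapMatrix (X.lap β) := by
    ext w v
    exact Ideal.Quotient.eq.2 (Ideal.mem_span_singleton.2 (X.omega_dvd_lap_sub h v w))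
  have hdet : π (X.lap α).det = π (X.lap β).det := by
    rw [RingHom.map_det π, RingHom.map_det π, hmap]
  exact Ideal.mem_span_singleton.1 (Ideal.Quotient.eq.1 hdet)

theorem theta_lapCol (X : Multigraph V E) (α : E → ℤ_[p]) (m : ℕ) (v : V) :
    theta V p m (X.lapCol α v) = (X.derived α m).firing ℤ_[p] (v, 0) := by
  classical
  have h1 : ∀ (u : V) (f : ℤ_[p]⟦X⟧), theta V p m (Pi.single u f) =
      divAction V p m f (Div.of (u, 0)) := fun u f => by
    rw [← theta_single]
  rw [firing_derived, lapCol, map_sum, ← Finset.sum_add_distrib, ← Finset.sum_neg_distrib]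
  refine Finset.sum_congr rfl fun e _ => ?_
  rw [map_add, neg_add, zero_add, zero_sub]
  congr 1
  · split_ifs
    · rw [map_sub, h1, h1, divAction_onePlusTPow_of, map_one, Module.End.one_apply, neg_sub,
        zero_add]
    · rw [map_zero, neg_zero]
  · split_ifs
    · rw [map_sub, h1, h1, divAction_onePlusTPow_of, map_one, Module.End.one_apply, neg_sub,
        zero_add, map_neg]
    · rw [map_zero, neg_zero]

theorem firingMap_divAction (X : Multigraph V E) (α : E → ℤ_[p]) (m : ℕ) (f : ℤ_[p]⟦X⟧)
    (d : Div ℤ_[p] (V × ZMod (p ^ m))) :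
    (X.derived α m).firingMap ℤ_[p] (divAction V p m f d) =
      divAction V p m f ((X.derived α m).firingMap ℤ_[p] d) := by
  refine action_intertwine le_rfl _ _ _ (fun d => ?_) f d
  rw [LinearMap.sub_apply, LinearMap.sub_apply, map_sub]
  congr 1
  refine LinearMap.congr_fun (f := (X.derived α m).firingMap ℤ_[p] ∘ₗ divShift V p m)
    (g := divShift V p m ∘ₗ (X.derived α m).firingMap ℤ_[p]) (Div.hom_ext fun w => ?_) d
  rw [LinearMap.comp_apply, LinearMap.comp_apply, divShift_of, firingMap_of, firingMap_of]
  exact (mapDomain_shift_firing ℤ_[p] X α m w).symm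

theorem lap_mulVec (X : Multigraph V E) (α : E → ℤ_[p]) (y : V → ℤ_[p]⟦X⟧) :
    (X.lap α).mulVec y = ∑ v, y v • X.lapCol α v := by
  ext1 w
  simp [Matrix.mulVec, dotProduct, lap, mul_comm]

/-- One matrix over Λ governs every layer: its reduction modulo ω_m is the Laplacian of X_m. -/
theorem theta_lap_mulVec (X : Multigraph V E) (α : E → ℤ_[p]) (m : ℕ) (y : V → ℤ_[p]⟦X⟧) :
    theta V p m ((X.lap α).mulVec y) = (X.derived α m).firingMap ℤ_[p] (theta V p m y) := by
  rw [lap_mulVec, map_sum, theta_apply, map_sum]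
  refine Finset.sum_congr rfl fun v _ => ?_
  rw [theta_smul, theta_lapCol, firingMap_divAction, firingMap_of]

/-- A kernel vector y gives at each level a divisor in the kernel of the Laplacian of a connected
graph, hence a constant one. The shift fixes constants, so T·y is divisible by every ω_m and
vanishes. -/
theorem det_lap_ne_zero [DecidableEq V] (X : Multigraph V E) (α : E → ℤ_[p])
    (h : ∀ m, (X.derived α m).Connected) : (X.lap α).det ≠ 0 := by
  intro hdet
  obtain ⟨y, hy0, hy⟩ := Matrix.exists_mulVec_eq_zero_iff.2 hdet
  apply hy0
  have hX : ∀ m, theta V p m ((PowerSeries.X : ℤ_[p]⟦X⟧) • y) = 0 := by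
    intro m
    have hconst := (h m).coeff_eq_of_firingMap_eq_zero (d := theta V p m y) (by
      rw [← theta_lap_mulVec, hy, map_zero])
    rw [theta_smul, divAction_X, LinearMap.sub_apply, Module.End.one_apply, sub_eq_zero]
    refine Div.ext fun w => ?_
    have hshift : Div.coeff w (divShift V p m (theta V p m y)) =
        Div.coeff (w.1, w.2 - 1) (theta V p m y) := by
      classical
      refine LinearMap.congr_fun (f := Div.coeff w ∘ₗ divShift V p m)
        (g := Div.coeff (w.1, w.2 - 1)) (Div.hom_ext fun u => ?_) _
      rw [LinearMap.comp_apply, divShift_of, Div.coeff_of, Div.coeff_of]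
      congr 1
      simp [Prod.ext_iff, eq_sub_iff_add_eq]
    rw [hshift, hconst]
  funext v
  have hv : PowerSeries.X * y v = 0 :=
    eq_zero_of_forall_omega_dvd fun m => omega_dvd_of_theta_eq_zero (hX m) v
  exact (mul_eq_zero.1 hv).resolve_left PowerSeries.X_ne_zero

end Laplacian

end Multigraph

/-! ### The Iwasawa module as a subquotient of `ℤ_p⟦T⟧^V` -/

namespace Multigraph

open Iwasawa

variable {V E : Type*} [Fintype E] {p : ℕ} [Fact p.Prime]

theorem levelAction_mk (X : Multigraph V E) (α : E → ℤ_[p]) {m : ℕ} {f : ℤ_[p]⟦X⟧}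
    {d d' : divZero ℤ_[p] (V × ZMod (p ^ m))}
    (h : (d' : Div ℤ_[p] (V × ZMod (p ^ m))) = divAction V p m f d) :
    X.levelAction α m f (Jacobian.mk _ d) = Jacobian.mk _ d' := by
  set τ : Module.End ℤ_[p] (divZero ℤ_[p] (V × ZMod (p ^ m))) :=
    divZeroMap (shift p V m) - 1 with hτ
  have hsub : ∀ x, (divZero ℤ_[p] (V × ZMod (p ^ m))).subtype (τ x) =
      (divShift V p m - 1) ((divZero ℤ_[p] (V × ZMod (p ^ m))).subtype x) := fun x => rfl
  have hω : Polynomial.aeval τ (omega p m) = 0 := by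
    refine LinearMap.ext fun x => Subtype.ext ?_
    have := aeval_intertwine _ hsub (omega p m) x
    rw [aeval_divShift] at this
    exact this
  have hd : d' = action m τ hω f d := by
    refine Subtype.ext (h.trans ?_)
    exact (action_intertwine le_rfl hω (aeval_divShift m) _ hsub f d).symm
  rw [hd]
  refine (action_intertwine le_rfl hω (aeval_gal X α le_rfl) (Jacobian.mk (X.derived α m))
    (fun x => ?_) f d).symm
  rw [hτ, LinearMap.sub_apply, LinearMap.sub_apply, map_sub]
  rfl

variable [Fintype V]

variable (V p) in
/-- The sum of the coordinates of a vector in `ℤ_p⟦T⟧^V`, modulo `T`. -/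
noncomputable def degreeMap : (V → ℤ_[p]⟦X⟧) →ₗ[ℤ_[p]⟦X⟧]
    ℤ_[p]⟦X⟧ ⧸ Ideal.span {(PowerSeries.X : ℤ_[p]⟦X⟧)} :=
  (Submodule.mkQ (Ideal.span {(PowerSeries.X : ℤ_[p]⟦X⟧)})) ∘ₗ ∑ v, LinearMap.proj v

theorem degreeMap_eq_zero_iff {y : V → ℤ_[p]⟦X⟧} :
    degreeMap V p y = 0 ↔ ∑ v, PowerSeries.constantCoeff (y v) = 0 := by
  rw [degreeMap, LinearMap.comp_apply, Submodule.mkQ_apply, Submodule.Quotient.mk_eq_zero,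
    Ideal.mem_span_singleton, PowerSeries.X_dvd_iff]
  simp [map_sum]

theorem degreeMap_eq_zero_iff_degree_theta (m : ℕ) {y : V → ℤ_[p]⟦X⟧} :
    degreeMap V p y = 0 ↔ theta V p m y ∈ divZero ℤ_[p] (V × ZMod (p ^ m)) := by
  rw [degreeMap_eq_zero_iff, divZero, LinearMap.mem_ker, degree_theta]

theorem degreeMap_surjective [Nonempty V] : Function.Surjective (degreeMap V p) := by
  classical
  intro x
  obtain ⟨f, rfl⟩ := Submodule.mkQ_surjective _ x
  let v : V := Classical.arbitrary V
  refine ⟨Pi.single v f, ?_⟩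
  rw [degreeMap, LinearMap.comp_apply]
  congr 1
  rw [LinearMap.sum_apply, Finset.sum_eq_single v]
  · simp
  · intro w _ hw
    simp [hw]
  · simp

theorem degreeMap_lap_mulVec (X : Multigraph V E) (α : E → ℤ_[p]) (y : V → ℤ_[p]⟦X⟧) :
    degreeMap V p ((X.lap α).mulVec y) = 0 := by
  rw [degreeMap_eq_zero_iff_degree_theta 0, theta_lap_mulVec]
  exact degree_firingMap _ _ _

/-- The map from vectors of degree zero to the Iwasawa module. -/
noncomputable def toJacobianLimit (X : Multigraph V E) (α : E → ℤ_[p]) :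
    LinearMap.ker (degreeMap V p) →ₗ[ℤ_[p]⟦X⟧] X.jacobianLimit α where
  toFun y := ⟨fun m => (Jacobian.mk (X.derived α m) ⟨theta V p m y,
      (degreeMap_eq_zero_iff_degree_theta m).1 y.2⟩ : (X.derived α m).Jacobian ℤ_[p]), fun m => by
    refine (jacobianMap_mk _ _ _).trans (congrArg (Jacobian.mk (X.derived α m)) ?_)
    exact Subtype.ext (map_proj_theta m (y : V → ℤ_[p]⟦X⟧))⟩
  map_add' y z := by
    refine Subtype.ext (funext fun m => ?_)
    refine Eq.trans (congrArg (Jacobian.mk (X.derived α m)) ?_)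
      (map_add (Jacobian.mk (X.derived α m)) _ _)
    exact Subtype.ext (map_add (theta V p m) (y : V → ℤ_[p]⟦X⟧) z)
  map_smul' f y := by
    refine Subtype.ext (funext fun m => ?_)
    exact (X.levelAction_mk α (theta_smul m f (y : V → ℤ_[p]⟦X⟧))).symm

theorem toJacobianLimit_apply (X : Multigraph V E) (α : E → ℤ_[p])
    (y : LinearMap.ker (degreeMap V p)) (m : ℕ) :
    (X.toJacobianLimit α y).1 m = (Jacobian.mk (X.derived α m) ⟨theta V p m y,
      (degreeMap_eq_zero_iff_degree_theta m).1 y.2⟩ : (X.derived α m).Jacobian ℤ_[p]) := rfl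

theorem Jacobian.mk_eq_zero_iff {R : Type*} [CommRing R] {V' E' : Type*} [Fintype E']
    (Y : Multigraph V' E') (d : divZero R V') :
    Jacobian.mk Y d = 0 ↔ (d : Div R V') ∈ LinearMap.range (Y.firingMap R) := by
  rw [range_firingMap]
  exact Submodule.Quotient.mk_eq_zero _

theorem theta_mem_range_firingMap_iff (X : Multigraph V E) (α : E → ℤ_[p]) (m : ℕ)
    (y : V → ℤ_[p]⟦X⟧) :
    theta V p m y ∈ LinearMap.range ((X.derived α m).firingMap ℤ_[p]) ↔
      ∃ a b, y = (X.lap α).mulVec a + (omega p m : ℤ_[p]⟦X⟧) • b := by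
  constructor
  · rintro ⟨d, hd⟩
    obtain ⟨a, rfl⟩ := theta_surjective m d
    rw [← theta_lap_mulVec, eq_comm, ← sub_eq_zero, ← map_sub, theta_eq_zero_iff] at hd
    obtain ⟨b, hb⟩ := hd
    exact ⟨a, b, by rw [← hb, add_sub_cancel]⟩
  · rintro ⟨a, b, rfl⟩
    refine ⟨theta V p m a, ?_⟩
    rw [map_add, theta_lap_mulVec, theta_eq_zero_iff.2 ⟨b, rfl⟩, add_zero]

open scoped PowerSeries.WithPiTopology in
theorem continuous_lap_mulVec (X : Multigraph V E) (α : E → ℤ_[p]) :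
    Continuous fun a : V → ℤ_[p]⟦X⟧ => (X.lap α).mulVec a :=
  Continuous.matrix_mulVec continuous_const continuous_id

-- Vanishing at level m only gives a preimage modulo ω_m, which may depend on m. The sets of such
-- preimages are closed, non-empty and decreasing, so compactness yields one preimage valid at all
-- levels.
open scoped PowerSeries.WithPiTopology in
theorem toJacobianLimit_eq_zero_iff (X : Multigraph V E) (α : E → ℤ_[p])
    (y : LinearMap.ker (degreeMap V p)) :
    X.toJacobianLimit α y = 0 ↔
      (y : V → ℤ_[p]⟦X⟧) ∈ LinearMap.range (X.lap α).mulVecLin := by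
  have : CompactSpace ℤ_[p]⟦X⟧ := compactSpace_powerSeries
  have h0 : X.toJacobianLimit α y = 0 ↔ ∀ m, ∃ a b, (y : V → ℤ_[p]⟦X⟧) =
      (X.lap α).mulVec a + (omega p m : ℤ_[p]⟦X⟧) • b := by
    rw [Subtype.ext_iff, funext_iff]
    refine forall_congr' fun m => ?_
    rw [← theta_mem_range_firingMap_iff]
    exact Jacobian.mk_eq_zero_iff _ _
  rw [h0]
  constructor
  · intro h
    let K : ℕ → Set (V → ℤ_[p]⟦X⟧) := fun m =>
      {a | ∃ b, (y : V → ℤ_[p]⟦X⟧) - (X.lap α).mulVec a = (omega p m : ℤ_[p]⟦X⟧) • b}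
    have hclosed : ∀ m, IsClosed (K m) := by
      intro m
      have hr : IsClosed (Set.range fun b : V → ℤ_[p]⟦X⟧ => (omega p m : ℤ_[p]⟦X⟧) • b) :=
        (isCompact_range (continuous_const_smul _)).isClosed
      have hc : Continuous fun a : V → ℤ_[p]⟦X⟧ =>
          (y : V → ℤ_[p]⟦X⟧) - (X.lap α).mulVec a :=
        continuous_const.sub (X.continuous_lap_mulVec α)
      convert hr.preimage hc using 1
      ext a
      simp [K, eq_comm]
    obtain ⟨a, ha⟩ := IsCompact.nonempty_iInter_of_sequence_nonempty_isCompact_isClosed K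
      (fun m a => by
        rintro ⟨b, hb⟩
        obtain ⟨t, ht⟩ := omega_dvd_omega_of_le (p := p) m.le_succ
        exact ⟨t • b, by rw [hb, smul_smul, ← ht]⟩)
      (fun m => by
        obtain ⟨a, b, hab⟩ := h m
        exact ⟨a, b, by rw [hab, add_sub_cancel_left]⟩)
      (hclosed 0).isCompact hclosed
    refine ⟨a, funext fun v => Eq.symm (sub_eq_zero.1 (eq_zero_of_forall_omega_dvd fun m => ?_))⟩
    obtain ⟨b, hb⟩ := Set.mem_iInter.1 ha m
    exact ⟨b v, congrFun hb v⟩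
  · rintro ⟨a, ha⟩ m
    exact ⟨a, 0, by rw [← ha, smul_zero, add_zero]; rfl⟩

-- Lifts y_m of the components of x differ from one level to the next by elements of the image of
-- the Laplacian plus ω_mΛ^V. The corresponding cosets are compact and decreasing, and a common
-- point lifts x.
open scoped PowerSeries.WithPiTopology in
theorem toJacobianLimit_surjective (X : Multigraph V E) (α : E → ℤ_[p]) :
    Function.Surjective (X.toJacobianLimit α) := by
  have : CompactSpace ℤ_[p]⟦X⟧ := compactSpace_powerSeries
  intro x
  have hd : ∀ m, ∃ d : divZero ℤ_[p] (V × ZMod (p ^ m)),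
      Jacobian.mk (X.derived α m) d = x.1 m := fun m => Jacobian.mk_surjective _ (x.1 m)
  choose d hd using hd
  choose y hy using fun m => theta_surjective m (d m : Div ℤ_[p] (V × ZMod (p ^ m)))
  have hstep : ∀ m, ∃ a b, y (m + 1) - y m =
      (X.lap α).mulVec a + (omega p m : ℤ_[p]⟦X⟧) • b := by
    intro m
    rw [← theta_mem_range_firingMap_iff, map_sub, ← map_proj_theta, hy, hy]
    have h1 : Jacobian.mk (X.derived α m)
        (divZeroMap (proj p V m) (d (m + 1)) - d m) = 0 := by
      rw [map_sub, sub_eq_zero, hd]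
      refine Eq.trans ?_ (x.2 m)
      rw [← hd]
      rfl
    exact (Jacobian.mk_eq_zero_iff _ _).1 h1
  obtain ⟨z, hz⟩ := exists_forall_exists_eq_add (p := p) (ι := V)
    (Z := (V → ℤ_[p]⟦X⟧) × (V → ℤ_[p]⟦X⟧))
    (fun m ab => y m + ((X.lap α).mulVec ab.1 + (omega p m : ℤ_[p]⟦X⟧) • ab.2))
    (fun m => continuous_const.add (((X.continuous_lap_mulVec α).comp continuous_fst).add
      ((continuous_const_smul (omega p m : ℤ_[p]⟦X⟧)).comp continuous_snd)))
    (fun m ab => by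
      obtain ⟨a, b, hab⟩ := hstep m
      obtain ⟨t, ht⟩ := omega_dvd_omega_of_le (p := p) m.le_succ
      refine ⟨(ab.1 + a, t • ab.2 + b), ?_⟩
      rw [sub_eq_iff_eq_add] at hab
      rw [Nat.succ_eq_add_one] at ht
      simp only
      rw [hab, ht, Matrix.mulVec_add, smul_add, smul_smul]
      abel)
  have hzm : ∀ m, theta V p m z - d m ∈
      LinearMap.range ((X.derived α m).firingMap ℤ_[p]) := by
    intro m
    obtain ⟨ab, rfl⟩ := hz m
    rw [← hy, ← map_sub, theta_mem_range_firingMap_iff]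
    exact ⟨_, _, add_sub_cancel_left _ _⟩
  -- The degree depends only on the constant terms of z, so it can be tested at level 0.
  have hz0 : degreeMap V p z = 0 := by
    rw [degreeMap_eq_zero_iff_degree_theta 0]
    obtain ⟨c, hc⟩ := hzm 0
    rw [← sub_add_cancel (theta V p 0 z) (d 0 : Div ℤ_[p] (V × ZMod (p ^ 0))), ← hc]
    exact Submodule.add_mem _ (degree_firingMap _ _ _) (d 0).2
  refine ⟨⟨z, hz0⟩, Subtype.ext (funext fun m => ?_)⟩
  rw [toJacobianLimit_apply, ← hd]
  refine sub_eq_zero.1 (Eq.trans (map_sub (Jacobian.mk (X.derived α m)) _ _).symm ?_)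
  exact (Jacobian.mk_eq_zero_iff _ _).2 (hzm m)

end Multigraph

/-! ### Characteristic power series -/

namespace Iwasawa

variable {p : ℕ} [Fact p.Prime]
variable {A : Type*} [AddCommGroup A] [Module ℤ_[p]⟦X⟧ A]
variable {B : Type*} [AddCommGroup B] [Module ℤ_[p]⟦X⟧ B]

theorem IsPseudoNull.localLength_eq_zero (h : IsPseudoNull p A) {q : ℤ_[p]⟦X⟧} (hq : Prime q) :
    localLength q A = 0 := by
  obtain ⟨f, g, hfg, h⟩ := h
  by_cases hf : q ∣ f
  · refine _root_.localLength_eq_zero (isRelPrime_of_prime_of_not_dvd hq fun hg => ?_)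
      fun a => (h a).2
    exact hq.not_isUnit (hfg hf hg)
  · exact _root_.localLength_eq_zero (isRelPrime_of_prime_of_not_dvd hq hf) fun a => (h a).1

/-- Length is additive, and the kernel and cokernel have local length zero because no prime divides
both of two coprime annihilators. -/
theorem IsPseudoIsomorphism.localLength_eq {φ : A →ₗ[ℤ_[p]⟦X⟧] B}
    (h : IsPseudoIsomorphism p φ) {q : ℤ_[p]⟦X⟧} (hq : Prime q) :
    localLength q A = localLength q B := by
  rw [localLength_eq_add_of_exact (LinearMap.ker φ).subtype φ.rangeRestrict
      (Submodule.subtype_injective _) φ.surjective_rangeRestrict (by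
        rw [LinearMap.exact_iff, LinearMap.ker_rangeRestrict, Submodule.range_subtype]),
    localLength_eq_add_of_exact (LinearMap.range φ).subtype (LinearMap.range φ).mkQ
      (Submodule.subtype_injective _) (Submodule.mkQ_surjective _)
      (LinearMap.exact_subtype_mkQ _),
    h.1.localLength_eq_zero hq, h.2.localLength_eq_zero hq, zero_add, add_zero]

theorem ne_zero_of_isRelPrime_p {g : ℤ_[p]⟦X⟧} (h : IsRelPrime g (p : ℤ_[p]⟦X⟧)) : g ≠ 0 := by
  rintro rfl
  exact prime_p_powerSeries.not_isUnit (isRelPrime_zero_left.1 h)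

theorem IsCharacteristicPowerSeries.ne_zero {F : ℤ_[p]⟦X⟧}
    (h : IsCharacteristicPowerSeries p A F) : F ≠ 0 := by
  obtain ⟨s, t, e, g, hg, -, rfl⟩ := h
  exact mul_ne_zero (pow_ne_zero _ prime_p_powerSeries.ne_zero)
    (Finset.prod_ne_zero_iff.2 fun j _ => ne_zero_of_isRelPrime_p (hg j))

/-- Its multiplicities are local lengths of the module, so a characteristic power series does not
depend, up to units, on the chosen elementary module. -/
theorem IsCharacteristicPowerSeries.ordAt_eq {F : ℤ_[p]⟦X⟧}
    (h : IsCharacteristicPowerSeries p A F) {q : ℤ_[p]⟦X⟧} (hq : Prime q) :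
    ordAt q F = localLength q A := by
  obtain ⟨s, t, e, g, hg, ⟨φ, hφ⟩, rfl⟩ := h
  have hp0 := (prime_p_powerSeries (p := p)).ne_zero
  have hg0 : ∀ j ∈ Finset.univ, g j ≠ 0 := fun j _ => ne_zero_of_isRelPrime_p (hg j)
  rw [hφ.localLength_eq hq, localLength_prod, localLength_pi, localLength_pi,
    ordAt_mul hq.not_isUnit _ (Finset.prod_ne_zero_iff.2 hg0), ordAt_prod hq.not_isUnit _ hg0,
    ← Finset.prod_pow_eq_pow_sum, ordAt_prod hq.not_isUnit _ fun _ _ => pow_ne_zero _ hp0]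
  simp only [localLength_quotient_span]

/-- A finitely generated module that is annihilated by a non-zero non-unit has a characteristic
power series. -/
theorem exists_isCharacteristicPowerSeries [Module.Finite ℤ_[p]⟦X⟧ A] {F : ℤ_[p]⟦X⟧} (hF : F ≠ 0)
    (hFu : ¬ IsUnit F) (hA : ∀ x : A, F • x = 0) :
    ∃ C, IsCharacteristicPowerSeries p A C := by
  classical
  obtain ⟨n, q, e, φ, s, hq, hqF, hs, hker, hcok⟩ :=
    Module.exists_linearMap_pi_prime_pow hF hFu hA
  let P : ℤ_[p]⟦X⟧ := (p : ℤ_[p]⟦X⟧)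
  -- Each summand Λ/(q^e) goes to the p-part if q is associated to p and to the other part
  -- otherwise. The unused slot is filled with exponent 0 or generator 1, that is, with a zero
  -- module.
  let e' : Fin n → ℕ := fun i => if Associated (q i) P then e i else 0
  let g : Fin n → ℤ_[p]⟦X⟧ := fun i => if Associated (q i) P then 1 else q i ^ e i
  have h1 : ∀ i, Ideal.span {q i ^ e i} ≤ Ideal.span {P ^ e' i} := by
    intro i
    rw [Ideal.span_singleton_le_span_singleton]
    by_cases h : Associated (q i) P
    · simp only [e', if_pos h]
      exact (h.pow_pow).symm.dvd
    · simp only [e', if_neg h, pow_zero, one_dvd]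
  have h2 : ∀ i, Ideal.span {q i ^ e i} ≤ Ideal.span {g i} := by
    intro i
    rw [Ideal.span_singleton_le_span_singleton]
    by_cases h : Associated (q i) P
    · simp only [g, if_pos h, one_dvd]
    · simp only [g, if_neg h, dvd_rfl]
  let ψ : (∀ i, ℤ_[p]⟦X⟧ ⧸ Ideal.span {q i ^ e i}) →ₗ[ℤ_[p]⟦X⟧] Elementary p e' g :=
    LinearMap.prod (.pi fun i => Submodule.factor (h1 i) ∘ₗ .proj i)
      (.pi fun i => Submodule.factor (h2 i) ∘ₗ .proj i)
  have hψinj : ∀ z, ψ z = 0 → z = 0 := by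
    intro z hz
    funext i
    obtain ⟨f, hf⟩ := Ideal.Quotient.mk_surjective (z i)
    have hz1 : Submodule.factor (h1 i) (z i) = 0 := congrFun (congrArg Prod.fst hz) i
    have hz2 : Submodule.factor (h2 i) (z i) = 0 := congrFun (congrArg Prod.snd hz) i
    rw [← hf] at hz1 hz2 ⊢
    have hz1' : P ^ e' i ∣ f := Ideal.mem_span_singleton.1 (Ideal.Quotient.eq_zero_iff_mem.1 hz1)
    have hz2' : g i ∣ f := Ideal.mem_span_singleton.1 (Ideal.Quotient.eq_zero_iff_mem.1 hz2)
    refine Ideal.Quotient.eq_zero_iff_mem.2 (Ideal.mem_span_singleton.2 ?_)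
    by_cases h : Associated (q i) P
    · simp only [e', if_pos h] at hz1'
      exact h.pow_pow.dvd.trans hz1'
    · simpa only [g, if_neg h] using hz2'
  have hψsurj : ∀ y, ∃ z, ψ z = y := by
    rintro ⟨a, b⟩
    choose a' ha' using fun i => Ideal.Quotient.mk_surjective (a i)
    choose b' hb' using fun i => Ideal.Quotient.mk_surjective (b i)
    refine ⟨fun i => Ideal.Quotient.mk _ (if Associated (q i) P then a' i else b' i), ?_⟩
    refine Prod.ext (funext fun i => ?_) (funext fun i => ?_)
    · refine Eq.trans ?_ (ha' i)
      refine Ideal.Quotient.eq.2 (Ideal.mem_span_singleton.2 ?_)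
      by_cases h : Associated (q i) P
      · simp [h]
      · simp [e', h]
    · refine Eq.trans ?_ (hb' i)
      refine Ideal.Quotient.eq.2 (Ideal.mem_span_singleton.2 ?_)
      by_cases h : Associated (q i) P
      · simp [g, h]
      · simp [h]
  have hsq : IsRelPrime s (∏ i, q i ^ e i) := IsRelPrime.prod_right fun i _ =>
    IsRelPrime.pow_right (hs.of_dvd_right (hqF i))
  refine ⟨_, n, n, e', g, fun j => ?_, ⟨ψ ∘ₗ φ, ?_, ?_⟩, rfl⟩
  · by_cases h : Associated (q j) P
    · simp only [g, if_pos h]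
      exact isRelPrime_one_left
    · simp only [g, if_neg h]
      refine IsRelPrime.pow_left (isRelPrime_of_prime_of_not_dvd prime_p_powerSeries fun hd => h ?_)
      exact (prime_p_powerSeries.associated_of_dvd (hq j) hd).symm
  -- The kernel is killed by the coprime pair s, F; the cokernel below by s and ∏ q_i^{e_i}, coprime
  -- since each q_i divides F.
  · refine ⟨s, F, hs, fun x => ⟨Subtype.ext ?_, Subtype.ext (hA _)⟩⟩
    exact hker _ (hψinj _ x.2)
  · refine ⟨s, ∏ i, q i ^ e i, hsq, fun y => ?_⟩
    obtain ⟨y, rfl⟩ := Submodule.Quotient.mk_surjective _ y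
    obtain ⟨z, rfl⟩ := hψsurj y
    refine ⟨(Submodule.Quotient.mk_eq_zero _).2 ?_, (Submodule.Quotient.mk_eq_zero _).2 ?_⟩
    · obtain ⟨x, hx⟩ := hcok z
      exact ⟨x, by rw [LinearMap.comp_apply, hx, map_smul]⟩
    · change (∏ i, q i ^ e i) • ψ z ∈ _
      rw [← map_smul]
      have : (∏ i, q i ^ e i) • z = 0 := by
        funext i
        obtain ⟨f, hf⟩ := Ideal.Quotient.mk_surjective (z i)
        rw [Pi.smul_apply, ← hf]
        refine Ideal.Quotient.eq_zero_iff_mem.2 (Ideal.mem_span_singleton.2 ?_)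
        exact (Finset.dvd_prod_of_mem (fun i => q i ^ e i) (Finset.mem_univ i)).mul_right _
      rw [this, map_zero]
      exact Submodule.zero_mem _

theorem X_mul_isDistinguishedAt {G : ℤ_[p][X]}
    (hG : G.IsDistinguishedAt (IsLocalRing.maximalIdeal ℤ_[p])) :
    (Polynomial.X * G).IsDistinguishedAt (IsLocalRing.maximalIdeal ℤ_[p]) := by
  refine ⟨⟨fun {i} hi => ?_⟩, Polynomial.monic_X.mul hG.monic⟩
  rw [Polynomial.natDegree_X_mul hG.monic.ne_zero] at hi
  cases i with
  | zero => simp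
  | succ i =>
    rw [Polynomial.coeff_X_mul]
    exact hG.mem (by omega)

variable {D : ℤ_[p]⟦X⟧}

/-- Equality of orders makes D associated to T·F, hence to p^m·(T·G), where T·G is distinguished of
degree l + 1. The factor T accounts for the shift by one. -/
theorem HasInvariants.hasShape (hD : D ≠ 0)
    (h : ∀ q, Prime q → ordAt q D = localLength q A + ordAt q PowerSeries.X) {m l : ℕ}
    (hA : HasInvariants p A m l) : HasShape D m (l + 1) := by
  obtain ⟨F, G, hF, hG, hFG, rfl⟩ := hA
  have hDF : Associated D (PowerSeries.X * F) := by
    refine associated_of_ordAt_eq hD (mul_ne_zero PowerSeries.X_ne_zero hF.ne_zero)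
      fun q hq => ?_
    rw [h q hq, ordAt_mul hq.not_isUnit _ hF.ne_zero, hF.ordAt_eq hq, add_comm]
  rw [← Polynomial.natDegree_X_mul hG.monic.ne_zero]
  refine hasShape_of_associated (X_mul_isDistinguishedAt hG) (hDF.trans ?_)
  rw [Polynomial.coe_mul, Polynomial.coe_X, mul_left_comm]
  exact hFG.mul_left _

/-- The invariants of a finitely generated torsion module can be read off from a power series with
the orders of `T` times a characteristic power series. -/
theorem hasShape_mu_lam [Module.Finite ℤ_[p]⟦X⟧ A] (hD : D ≠ 0)
    (h : ∀ q, Prime q → ordAt q D = localLength q A + ordAt q PowerSeries.X)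
    (hA : ∀ x : A, D • x = 0) : HasShape D (mu p A) (lam p A + 1) := by
  -- The annihilator T·D is used in place of D because it is visibly a non-unit.
  have hX : ¬ IsUnit (PowerSeries.X * D) := fun hu =>
    PowerSeries.X_prime.not_isUnit (isUnit_of_mul_isUnit_left hu)
  obtain ⟨F, hF⟩ := exists_isCharacteristicPowerSeries (p := p) (A := A)
    (mul_ne_zero PowerSeries.X_ne_zero hD) hX fun x => by rw [mul_smul, hA, smul_zero]
  obtain ⟨m, G, hG, hFG⟩ := exists_associated_distinguished hF.ne_zero
  have hinv : HasInvariants p A m G.natDegree := ⟨F, G, hF, hG, hFG, rfl⟩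
  have hshape := hinv.hasShape hD h
  -- Uniqueness of the shape of D makes the sets defining the invariants singletons, so their infima
  -- are the actual values.
  have hm : {m | ∃ l, HasInvariants p A m l} = {m} := by
    ext m'
    constructor
    · rintro ⟨l, hl⟩
      exact ((hl.hasShape hD h).unique hshape).1
    · rintro rfl
      exact ⟨_, hinv⟩
  have hl : {l | ∃ m, HasInvariants p A m l} = {G.natDegree} := by
    ext l
    constructor
    · rintro ⟨m', hl⟩
      exact Nat.succ_injective ((hl.hasShape hD h).unique hshape).2
    · rintro rfl
      exact ⟨_, hinv⟩
  rw [mu, lam, hm, hl, csInf_singleton, csInf_singleton]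
  exact hshape

end Iwasawa

/-! ### The exact sequence J_∞ → coker → Λ/(T) and the determinant. -/

namespace Multigraph

open Iwasawa

variable {V E : Type*} [Fintype V] [Fintype E] {p : ℕ} [Fact p.Prime]

/-- The embedding of the Iwasawa module, given as a quotient of the kernel of the degree map, into
the cokernel of the voltage Laplacian. -/
noncomputable def jacobianLimitToCokernel (X : Multigraph V E) (α : E → ℤ_[p]) :
    (LinearMap.ker (degreeMap V p) ⧸ LinearMap.ker (X.toJacobianLimit α)) →ₗ[ℤ_[p]⟦X⟧]
      (V → ℤ_[p]⟦X⟧) ⧸ LinearMap.range (X.lap α).mulVecLin :=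
  Submodule.mapQ _ _ (LinearMap.ker (degreeMap V p)).subtype fun y hy =>
    (X.toJacobianLimit_eq_zero_iff α y).1 hy

theorem jacobianLimitToCokernel_injective (X : Multigraph V E) (α : E → ℤ_[p]) :
    Function.Injective (X.jacobianLimitToCokernel α) := by
  rw [← LinearMap.ker_eq_bot, LinearMap.ker_eq_bot']
  intro y hy
  obtain ⟨y, rfl⟩ := Submodule.Quotient.mk_surjective _ y
  refine (Submodule.Quotient.mk_eq_zero _).2 ((X.toJacobianLimit_eq_zero_iff α y).2 ?_)
  exact (Submodule.Quotient.mk_eq_zero _).1 hy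

/-- The degree map on the cokernel of the voltage Laplacian. -/
noncomputable def cokernelDegree (X : Multigraph V E) (α : E → ℤ_[p]) :
    ((V → ℤ_[p]⟦X⟧) ⧸ LinearMap.range (X.lap α).mulVecLin) →ₗ[ℤ_[p]⟦X⟧]
      ℤ_[p]⟦X⟧ ⧸ Ideal.span {(PowerSeries.X : ℤ_[p]⟦X⟧)} :=
  Submodule.liftQ _ (degreeMap V p) (by
    rintro _ ⟨y, rfl⟩
    exact X.degreeMap_lap_mulVec α y)

theorem cokernelDegree_surjective [Nonempty V] (X : Multigraph V E) (α : E → ℤ_[p]) :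
    Function.Surjective (X.cokernelDegree α) := by
  intro x
  obtain ⟨y, hy⟩ := degreeMap_surjective (V := V) x
  exact ⟨Submodule.Quotient.mk y, hy⟩

theorem exact_cokernelDegree (X : Multigraph V E) (α : E → ℤ_[p]) :
    Function.Exact (X.jacobianLimitToCokernel α) (X.cokernelDegree α) := by
  intro y
  obtain ⟨y, rfl⟩ := Submodule.Quotient.mk_surjective _ y
  constructor
  · intro hy
    exact ⟨Submodule.Quotient.mk ⟨y, hy⟩, rfl⟩
  · rintro ⟨z, hz⟩
    obtain ⟨z, rfl⟩ := Submodule.Quotient.mk_surjective _ z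
    rw [← hz]
    exact z.2

/-- The order of the determinant is the local length of the cokernel, and length is additive along
the exact sequence. -/
theorem ordAt_det_lap [DecidableEq V] (X : Multigraph V E) (α : E → ℤ_[p])
    (h : ∀ m, (X.derived α m).Connected) {q : ℤ_[p]⟦X⟧} (hq : Prime q) :
    ordAt q (X.lap α).det = localLength q (X.jacobianLimit α) + ordAt q PowerSeries.X := by
  have : Nonempty (V × ZMod (p ^ 0)) := (h 0).nonempty
  have : Nonempty V := this.map Prod.fst
  rw [← localLength_quotient_range_mulVecLin hq _ (X.det_lap_ne_zero α h),
    localLength_eq_add_of_exact _ _ (X.jacobianLimitToCokernel_injective α)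
      (X.cokernelDegree_surjective α) (X.exact_cokernelDegree α), localLength_quotient_span,
    localLength_congr ((X.toJacobianLimit α).quotKerEquivOfSurjective
      (X.toJacobianLimit_surjective α))]

theorem finite_jacobianLimit (X : Multigraph V E) (α : E → ℤ_[p]) :
    Module.Finite ℤ_[p]⟦X⟧ (X.jacobianLimit α) :=
  Module.Finite.of_surjective _ (X.toJacobianLimit_surjective α)

/-- Multiplication by the determinant factors through the Laplacian by way of the adjugate, and J_∞
is a quotient in which the image of the Laplacian vanishes. -/
theorem det_lap_smul [DecidableEq V] (X : Multigraph V E) (α : E → ℤ_[p])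
    (x : X.jacobianLimit α) : (X.lap α).det • x = 0 := by
  obtain ⟨y, rfl⟩ := X.toJacobianLimit_surjective α x
  rw [← map_smul, toJacobianLimit_eq_zero_iff]
  refine ⟨(X.lap α).adjugate.mulVec y, ?_⟩
  rw [Matrix.mulVecLin_apply, Matrix.mulVec_mulVec, Matrix.mul_adjugate, Matrix.smul_mulVec,
    Matrix.one_mulVec]
  rfl

end Multigraph

namespace VoltageCover

open Iwasawa

variable {p : ℕ} [Fact p.Prime] {V E : Type*} {X : Multigraph V E}

theorem hasShape_det_lap [Fintype V] [Fintype E] [DecidableEq V] (Y : VoltageCover p X) :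
    HasShape (X.lap Y.voltage).det Y.mu (Y.lam + 1) := by
  have := X.finite_jacobianLimit Y.voltage
  exact hasShape_mu_lam (X.det_lap_ne_zero _ Y.connected)
    (fun q hq => X.ordAt_det_lap _ Y.connected hq) (X.det_lap_smul _)

/-! ### The topology on the space of voltage covers -/

theorem mem_basic_self (Y : VoltageCover p X) (m : ℕ) : Y ∈ basic Y m := fun _ => rfl

theorem basic_antitone (Y : VoltageCover p X) {m n : ℕ} (h : m ≤ n) : basic Y n ⊆ basic Y m := by
  intro Z hZ e
  have key : ∀ x : ℤ_[p], PadicInt.toZModPow m x =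
      ZMod.castHom (pow_dvd_pow p h) (ZMod (p ^ m)) (PadicInt.toZModPow n x) := fun x =>
    (DFunLike.congr_fun (PadicInt.zmod_cast_comp_toZModPow m n h) x).symm
  rw [key, key, hZ e]

theorem basic_mem_nhds (Y : VoltageCover p X) (m : ℕ) : basic Y m ∈ 𝓝 Y :=
  IsOpen.mem_nhds (TopologicalSpace.GenerateOpen.basic _ ⟨Y, m, rfl⟩) (mem_basic_self Y m)

theorem exists_basic_subset_of_mem_nhds {Y : VoltageCover p X} {U : Set (VoltageCover p X)}
    (hU : U ∈ 𝓝 Y) : ∃ m, basic Y m ⊆ U := by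
  obtain ⟨t, htU, ht, hYt⟩ := mem_nhds_iff.1 hU
  suffices ∀ Y ∈ t, ∃ m, basic Y m ⊆ t by
    obtain ⟨m, hm⟩ := this Y hYt
    exact ⟨m, hm.trans htU⟩
  clear hU htU hYt U Y
  induction ht with
  | basic s hs =>
    obtain ⟨Z, m, rfl⟩ := hs
    intro Y hY
    -- A congruence class modulo p^m is a basic set around each of its points.
    exact ⟨m, fun W hW e => (hW e).trans (hY e)⟩
  | univ => exact fun Y _ => ⟨0, Set.subset_univ _⟩
  | inter s t _ _ ihs iht =>
    rintro Y ⟨hs, ht⟩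
    obtain ⟨m, hm⟩ := ihs Y hs
    obtain ⟨n, hn⟩ := iht Y ht
    exact ⟨max m n, Set.subset_inter ((basic_antitone Y (le_max_left _ _)).trans hm)
      ((basic_antitone Y (le_max_right _ _)).trans hn)⟩
  | sUnion S _ ih =>
    rintro Y ⟨s, hs, hY⟩
    obtain ⟨m, hm⟩ := ih s hs Y hY
    exact ⟨m, hm.trans (Set.subset_sUnion_of_mem hs)⟩

/-! ### Invariants of nearby covers. -/

variable [Fintype V] [Fintype E]

theorem mu_le_of_mem_basic {Y Z : VoltageCover p X} {n : ℕ} (hn : Y.mu + 1 + (Y.lam + 1) ≤ n)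
    (hZ : Z ∈ basic Y n) : Z.mu ≤ Y.mu ∧ (Z.mu = Y.mu → Z.lam = Y.lam) := by
  classical
  have h := Y.hasShape_det_lap.le_of_omega_dvd Z.hasShape_det_lap hn (X.omega_dvd_det_lap_sub hZ)
  exact ⟨h.1, fun hmu => Nat.succ_injective (h.2 hmu)⟩

theorem le_lam_of_mem_basic {Y Z : VoltageCover p X} {n N : ℕ} (hn : Y.mu + N ≤ n)
    (hZ : Z ∈ basic Y n) (hmu : Z.mu < Y.mu) : N ≤ Z.lam := by
  classical
  exact Nat.le_of_lt_succ (Y.hasShape_det_lap.lt_of_omega_dvd Z.hasShape_det_lap hn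
    (X.omega_dvd_det_lap_sub hZ) hmu)

end VoltageCover

theorem corollary6p7 {p : ℕ} [Fact p.Prime] {V E : Type*} [Fintype V] [Fintype E]
    (X : Multigraph V E) (Xinf : VoltageCover p X) (U : Set (VoltageCover p X)) (hU : U ∈ 𝓝 Xinf) :
    ∃ U' ∈ 𝓝 Xinf, U' ⊆ U ∧
      Xor (∀ Y ∈ U', Y.mu = Xinf.mu) (¬ BddAbove (VoltageCover.lam '' U')) := by
  obtain ⟨m, hm⟩ := VoltageCover.exists_basic_subset_of_mem_nhds hU
  -- Congruence modulo p^{n₀} keeps covers in U and fixes the coefficients of the determinant up to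
  -- index λ + 1 modulo p^{μ+1}.
  set n₀ := max m (Xinf.mu + 1 + (Xinf.lam + 1)) with hn₀
  have hle : ∀ Y ∈ Xinf.basic n₀, Y.mu ≤ Xinf.mu ∧ (Y.mu = Xinf.mu → Y.lam = Xinf.lam) :=
    fun Y hY => VoltageCover.mu_le_of_mem_basic (le_max_right _ _) hY
  have hsub : Xinf.basic n₀ ⊆ U := (Xinf.basic_antitone (le_max_left _ _)).trans hm
  -- If μ is constant on some smaller basic neighbourhood, λ is constant there as well, so the
  -- alternatives exclude each other. Otherwise the neighbourhood of level n₀ itself has unbounded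
  -- λ.
  by_cases h : ∃ n ≥ n₀, ∀ Y ∈ Xinf.basic n, Y.mu = Xinf.mu
  · obtain ⟨n, hn, hmu⟩ := h
    refine ⟨_, Xinf.basic_mem_nhds n, (Xinf.basic_antitone hn).trans hsub,
      Or.inl ⟨hmu, not_not.2 ⟨Xinf.lam, ?_⟩⟩⟩
    rintro _ ⟨Y, hY, rfl⟩
    exact ((hle Y (Xinf.basic_antitone hn hY)).2 (hmu Y hY)).le
  · push Not at h
    refine ⟨Xinf.basic n₀, Xinf.basic_mem_nhds n₀, hsub, Or.inr ⟨?_, ?_⟩⟩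
    · rintro ⟨N, hN⟩
      -- For a supposed bound N on λ, a cover with smaller μ is taken so close that its λ is at
      -- least N + 1; it still lies in the neighbourhood of level n₀.
      obtain ⟨Y, hY, hne⟩ := h (max n₀ (Xinf.mu + (N + 1))) (le_max_left _ _)
      have hY₀ := Xinf.basic_antitone (le_max_left _ _) hY
      have := VoltageCover.le_lam_of_mem_basic (le_max_right _ _) hY
        (lt_of_le_of_ne (hle Y hY₀).1 hne)
      have := hN (Set.mem_image_of_mem _ hY₀)
      omega
    · intro hmu
      obtain ⟨Y, hY, hne⟩ := h n₀ le_rfl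
      exact hne (hmu Y hY)
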